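/- Let $k\ge 0$ be an integer and $\sigma>0$, and let $c_1,c_2$ be constants with $c_1>\sqrt2\,\sigma$. For a matrix $\Delta\in\mathbb R^{r\times n}$ let $M(\Delta)$ be the largest $\ell_2$ norm of a column of its Moore–Penrose pseudoinverse $\Delta^\dagger$. Observe $y=\beta_0+\epsilon$ with $\epsilon\sim\mathcal N(0,\sigma^2 I_n)$, and let $$\hat\beta=\operatorname*{argmin}_{\beta\in\mathbb R^n}\ \tfrac12\|y-\beta\|_2^2+\lambda\|\Delta\beta\|_1,\qquad c_1M(\Delta)\sqrt{\log r}\le\lambda\le c_2M(\Delta)\sqrt{\log r}.$$ All $O_{\mathbb P}$ statements are along a sequence of problems with $n\to\infty$, in which $\beta_0$, $\lambda$, $p$, $d$ and the graph may vary with $n$, while $k,\sigma,c_1,c_2$ (and $\delta$ below) are fixed. 1. (Univariate trend filtering.) Let $\Delta=D^{(k+1)}\in\mathbb R^{(n-k-1)\times n}$, where $D^{(1)}$ is the first difference operator (row $i$ has $-1$ in column $i$ and $1$ in column $i+1$) and $D^{(j+1)}=D^{(1)}D^{(j)}$, with $D^{(1)}$ of the matching size. Then $$\frac{\|\hat\beta-\beta_0\|_2^2}{n}=O_{\mathbb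 P}\left(\frac1n+\sqrt{\frac{\log n}{n}}\cdot n^k\|D^{(k+1)}\beta_0\|_1\right).$$ For a graph $G$ on $n$ vertices let $\Delta^{(1)}$ be its oriented incidence matrix, with one row per edge, and let $\Delta^{(k+1)}=(\Delta^{(1)})^\top\Delta^{(k)}$ for odd $k$ and $\Delta^{(k+1)}=\Delta^{(1)}\Delta^{(k)}$ for even $k\ge2$. Take $\Delta=\Delta^{(k+1)}$. 2. (Erdős–Rényi graphs.) Let $G$ be an Erdős–Rényi random graph on $n$ vertices with edge probability $p$, independent of $\epsilon$; $\beta_0$ and $\lambda$ may depend on $G$. Put $d=np$, and suppose that $d\ge(1+\delta)\log n$ for all large $n$, for some fixed $\delta>0$. Then $$\frac{\|\hat\beta-\beta_0\|_2^2}{n}=O_{\mathbb P}\left(\frac1n+\frac{\sqrt{\log(nd)}}{n\,d^{(k+1)/2}}\cdot\|\Delta^{(k+1)}\beta_0\|_1\right).$$ 3. (Ramanujan graphs.) Let $G$ be a Ramanujan $d$-regular graph on $n$ vertices with $d\ge3$, that is, a connected $d$-regular graph each of whose adjacency eigenvalues $\mu$ satisfies $|\mu|=d$ or $|\mu|\le2\sqrt{d-1}$.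 Then $$\frac{\|\hat\beta-\beta_0\|_2^2}{n}=O_{\mathbb P}\left(\frac1n+\frac{\sqrt{\log(nd)}}{n\,d^{(k+1)/2}}\cdot\|\Delta^{(k+1)}\beta_0\|_1\right).$$ -/

import Mathlib

open MeasureTheory ProbabilityTheory Filter Matrix
open scoped NNReal

namespace GTF

/-! ## Norms, pseudoinverse, generalized lasso -/

/-- The `ℓ₁` norm of a real vector. -/
def l1 {r : Type*} [Fintype r] (v : r → ℝ) : ℝ := ∑ i, |v i|

/-- The squared `ℓ₂` norm of a real vector. -/
def sqNorm {r : Type*} [Fintype r] (v : r → ℝ) : ℝ := ∑ i, v i ^ 2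

/-- The Moore-Penrose pseudoinverse of a real matrix, `A† = (Aᵀ A)⁺ Aᵀ`, where `(Aᵀ A)⁺` inverts
the nonzero eigenvalues of the symmetric matrix `Aᵀ A` (recall `0⁻¹ = 0`). -/
noncomputable def pinv {r n : Type*} [Fintype r] [Fintype n] [DecidableEq n]
    (A : Matrix r n ℝ) : Matrix n r ℝ :=
  let h : (Aᴴ * A).IsHermitian := isHermitian_conjTranspose_mul_self A
  (h.eigenvectorUnitary : Matrix n n ℝ) * diagonal (fun i => (h.eigenvalues i)⁻¹) *
    (h.eigenvectorUnitary : Matrix n n ℝ)ᴴ * Aᵀ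

/-- `pinv A` satisfies the four Penrose equations, which determine it uniquely. -/
theorem pinv_penrose {r n : Type*} [Fintype r] [Fintype n] [DecidableEq n]
    (A : Matrix r n ℝ) :
    A * pinv A * A = A ∧ pinv A * A * pinv A = pinv A ∧
      (A * pinv A)ᵀ = A * pinv A ∧ (pinv A * A)ᵀ = pinv A * A := by
  set h : (Aᴴ * A).IsHermitian := isHermitian_conjTranspose_mul_self A with hh
  set U : Matrix n n ℝ := (h.eigenvectorUnitary : Matrix n n ℝ) with hU
  set Λ : n → ℝ := h.eigenvalues with hΛ
  have hUU : Uᵀ * U = 1 := by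
    have := Unitary.coe_star_mul_self h.eigenvectorUnitary
    simpa [hU, star_eq_conjTranspose, conjTranspose_eq_transpose_of_trivial] using this
  have hG : Aᵀ * A = U * diagonal Λ * Uᵀ := by
    have := h.spectral_theorem
    simpa [hU, hΛ, Unitary.conjStarAlgAut_apply, star_eq_conjTranspose,
      conjTranspose_eq_transpose_of_trivial, Function.comp_def] using this
  have hp : pinv A = U * diagonal (fun i => (Λ i)⁻¹) * Uᵀ * Aᵀ := by
    simp only [pinv, conjTranspose_eq_transpose_of_trivial, hU, hΛ]
  set S : Matrix n n ℝ := U * diagonal (fun i => (Λ i)⁻¹) * Uᵀ with hS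
  have hST : Sᵀ = S := by
    simp [hS, transpose_mul, Matrix.mul_assoc]
  have mulDiag : ∀ a b : n → ℝ, (U * diagonal a * Uᵀ) * (U * diagonal b * Uᵀ)
      = U * diagonal (fun i => a i * b i) * Uᵀ := by
    intro a b
    calc (U * diagonal a * Uᵀ) * (U * diagonal b * Uᵀ)
        = U * diagonal a * (Uᵀ * U) * diagonal b * Uᵀ := by simp only [Matrix.mul_assoc]
      _ = _ := by rw [hUU, Matrix.mul_one, Matrix.mul_assoc U, diagonal_mul_diagonal]
  have hGSG : (Aᵀ * A) * S * (Aᵀ * A) = Aᵀ * A := by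
    rw [hG, hS, mulDiag, mulDiag]
    congr 3
    funext i
    by_cases h0 : Λ i = 0 <;> simp [h0]
  have hSGS : S * (Aᵀ * A) * S = S := by
    rw [hG, hS, mulDiag, mulDiag]
    congr 3
    funext i
    by_cases h0 : Λ i = 0 <;> simp [h0]
  have hcomm : S * (Aᵀ * A) = (Aᵀ * A) * S := by
    rw [hG, hS, mulDiag, mulDiag]
    congr 3
    funext i
    ring
  rw [hp]
  refine ⟨?_, ?_, ?_, ?_⟩
  · have key : (A * (S * Aᵀ) * A - A)ᴴ * (A * (S * Aᵀ) * A - A) = 0 := by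
      rw [conjTranspose_eq_transpose_of_trivial]
      have e : (A * (S * Aᵀ) * A - A)ᵀ * (A * (S * Aᵀ) * A - A)
          = (Aᵀ * A * S * (Aᵀ * A)) * S * (Aᵀ * A) - (Aᵀ * A) * S * (Aᵀ * A)
            - ((Aᵀ * A) * S * (Aᵀ * A) - Aᵀ * A) := by
        simp only [transpose_sub, transpose_mul, transpose_transpose, hST, Matrix.mul_sub,
          Matrix.sub_mul, Matrix.mul_assoc]
      rw [e, hGSG, hGSG]
      simp
    exact sub_eq_zero.1 (conjTranspose_mul_self_eq_zero.1 key)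
  · calc S * Aᵀ * A * (S * Aᵀ) = (S * (Aᵀ * A) * S) * Aᵀ := by simp only [Matrix.mul_assoc]
      _ = _ := by rw [hSGS]
  · simp only [transpose_mul, transpose_transpose, hST, Matrix.mul_assoc]
  · calc (S * Aᵀ * A)ᵀ = (Aᵀ * A) * S := by
          simp only [transpose_mul, transpose_transpose, hST, Matrix.mul_assoc]
      _ = S * Aᵀ * A := by rw [← hcomm, Matrix.mul_assoc S]

/-- `M(Δ)`: the maximum `ℓ₂` norm of the columns of `Δ†`. -/
noncomputable def maxColNorm {r n : Type*} [Fintype r] [Fintype n] [DecidableEq n]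
    (A : Matrix r n ℝ) : ℝ :=
  ⨆ j : r, √(sqNorm fun i => pinv A i j)

/-- `M(Δ) √(log r)`, with `r` the number of rows of `Δ`. -/
noncomputable def tuningScale {r n : Type*} [Fintype r] [Fintype n] [DecidableEq n]
    (A : Matrix r n ℝ) : ℝ :=
  maxColNorm A * √(Real.log (Fintype.card r))

/-- `b` is the generalized lasso estimate: it minimizes `½‖y - β‖₂² + lam ‖Δ β‖₁` over `β`. -/
def IsGenLasso {r n : Type*} [Fintype r] [Fintype n] (A : Matrix r n ℝ) (lam : ℝ)
    (y b : n → ℝ) : Prop :=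
  IsMinOn (fun β : n → ℝ => 1 / 2 * sqNorm (y - β) + lam * l1 (A *ᵥ β)) Set.univ b

/-! ## Univariate difference operators -/

/-- The `(m-1) × m` first difference operator: row `i` has `-1` in column `i` and `1` in column
`i + 1`. -/
def firstDiff (m : ℕ) : Matrix (Fin (m - 1)) (Fin m) ℝ :=
  fun i j => if (j : ℕ) = i then -1 else if (j : ℕ) = i + 1 then 1 else 0

/-- The univariate difference operator `D^{(j)}` on `ℝⁿ`, with `n - j` rows:
`D^{(j+1)} = D^{(1)} D^{(j)}`, with `D^{(0)} = I`. -/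
def univDiff (n : ℕ) : (j : ℕ) → Matrix (Fin (n - j)) (Fin n) ℝ
  | 0 => (1 : Matrix (Fin n) (Fin n) ℝ)
  | j + 1 => firstDiff (n - j) * univDiff n j

/-! ## Graph difference operators -/

/-- The edges of a graph on `{0, …, n-1}`, each listed once, as a pair `(i, j)` with `i < j`. -/
def Edge {n : ℕ} (G : SimpleGraph (Fin n)) : Type :=
  {e : Fin n × Fin n // e.1 < e.2 ∧ G.Adj e.1 e.2}

noncomputable instance instFintypeEdge {n : ℕ} (G : SimpleGraph (Fin n)) : Fintype (Edge G) :=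
  @Fintype.ofFinite _ (inferInstanceAs
    (Finite {e : Fin n × Fin n // e.1 < e.2 ∧ G.Adj e.1 e.2}))

/-- The oriented incidence matrix: the row of the edge `(i, j)` has `-1` in column `i` and `1` in
column `j`. -/
def incidence {n : ℕ} (G : SimpleGraph (Fin n)) : Matrix (Edge G) (Fin n) ℝ :=
  fun e v => if v = e.1.1 then -1 else if v = e.1.2 then 1 else 0

/-- The index set of the rows of `Δ^{(k+1)}`: the edges for even `k`, the vertices for odd `k`. -/
def GraphRow {n : ℕ} (G : SimpleGraph (Fin n)) : ℕ → Type
  | 0 => Edge G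
  | 1 => Fin n
  | k + 2 => GraphRow G k

noncomputable instance instFintypeGraphRow {n : ℕ} (G : SimpleGraph (Fin n)) :
    (k : ℕ) → Fintype (GraphRow G k)
  | 0 => instFintypeEdge G
  | 1 => (inferInstance : Fintype (Fin n))
  | k + 2 => instFintypeGraphRow G k

/-- The factor that leads from `Δ^{(k+1)}` to `Δ^{(k+2)}`: `(Δ^{(1)})ᵀ` for even `k` and `Δ^{(1)}`
for odd `k`. -/
def graphStep {n : ℕ} (G : SimpleGraph (Fin n)) :
    (k : ℕ) → Matrix (GraphRow G (k + 1)) (GraphRow G k) ℝ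
  | 0 => (incidence G)ᵀ
  | 1 => incidence G
  | k + 2 => graphStep G k

/-- `graphDiff G k` is the graph difference operator `Δ^{(k+1)}` of order `k + 1`. -/
noncomputable def graphDiff {n : ℕ} (G : SimpleGraph (Fin n)) :
    (k : ℕ) → Matrix (GraphRow G k) (Fin n) ℝ
  | 0 => incidence G
  | k + 1 => graphStep G k * graphDiff G k

open Classical in
/-- A (possibly bipartite) Ramanujan `d`-regular graph: it is connected and `d`-regular, and every
adjacency eigenvalue other than `± d` has absolute value at most `2 √(d - 1)`. -/
def IsRamanujan {n : ℕ} (G : SimpleGraph (Fin n)) (d : ℕ) : Prop :=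
  G.Connected ∧ G.IsRegularOfDegree d ∧
    ∀ μ : ℝ, Module.End.HasEigenvalue (Matrix.toLin' (G.adjMatrix ℝ)) μ →
      |μ| = d ∨ |μ| ≤ 2 * √((d : ℝ) - 1)

/-! ## Noise and stochastic order -/

/-- The law `N(0, σ² I)` of the noise vector on `ℝⁿ`. -/
noncomputable def noise (σ : ℝ≥0) (n : ℕ) : Measure (Fin n → ℝ) :=
  Measure.pi fun _ => gaussianReal 0 (σ ^ 2)

/-- `X_m = O_P(R_m)` as `m → ∞`, where `X_m` and `R_m` are defined on the probability space
`(Ω_m, P_m)`: for every `η > 0` there is `C` with `P_m(|X_m| > C |R_m|) ≤ η` for all large `m`. -/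
def IsBigOP {Ω : ℕ → Type*} [∀ m, MeasurableSpace (Ω m)] (P : ∀ m, Measure (Ω m))
    (X R : ∀ m, Ω m → ℝ) : Prop :=
  ∀ η : ℝ, 0 < η → ∃ C : ℝ, ∀ᶠ m in atTop,
    P m {ω | C * |R m ω| < |X m ω|} ≤ ENNReal.ofReal η

end GTF

/-!
The three error bounds follow from one deterministic inequality. Write the noise as the sum of its
projection onto the null space of `Δ` and of `Δ†Δ ε`. When the penalty level `λ` dominates
`‖(Δ†)ᵀε‖_∞`, Hölder's inequality absorbs the second part into the penalty, and comparing the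
objective at `β̂` and at `β₀` gives (`sqNorm_error_le`)
`‖β̂ - β₀‖² ≤ 4 ‖(I - Δ†Δ) ε‖² + 8 λ ‖Δ β₀‖₁`.
The entries of `(Δ†)ᵀε` are Gaussian with standard deviation at most `σ M(Δ)`, so by a union bound
and `c₁ > √2 σ` this domination fails with probability at most `2 r^{1 - c₁²/(2σ²)} → 0`, and the first
term has expectation `4 σ²` times the nullity. Hence for bounded nullity the error is governed by
`M(Δ) √(log r)` (`genLasso_error_uniform`), and it remains to bound `M(Δ)`.

* For univariate differences, iterated summation is a right inverse of `D^{(k+1)}` with entries at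
  most `n^k`, and the columns of the pseudoinverse are projections of its columns.
* For graphs, a Laplacian spectral gap `g` gives `‖Δ^{(k+1)}x‖² ≥ g^{k+1} ‖x‖²` for `x` of zero
  mean, so that the null space consists of the constants and `M(Δ^{(k+1)}) ≤ g^{-(k+1)/2}`. One
  needs a gap of the order of `d`.
* For Ramanujan graphs of degree `d ≥ 3` the gap is at least `d - 2√(d-1) ≥ d / 20`.
* For Erdős–Rényi graphs with `np ≥ (1 + δ) log n`, matrix concentration is too weak near the
  connectivity threshold when `δ` is small. Instead, Chernoff bounds for the numbers of edges across
  cuts and a union bound over all vertex sets show that, with high probability, every set `S` of at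
  most half the vertices has at least `c np |S|` boundary edges and all degrees are at most `4np`.
  Cheeger's inequality (`cheeger`) turns this into a gap of order `np` (`binomialRandom_hasGap`).
-/

namespace GTF

/-! ### Pseudoinverse and the basic inequality -/

section LinearAlgebra

variable {r n : Type*} [Fintype r] [Fintype n]

lemma sqNorm_eq_dotProduct (v : n → ℝ) : sqNorm v = v ⬝ᵥ v := by
  simp [sqNorm, dotProduct, sq]

lemma sqNorm_nonneg (v : n → ℝ) : 0 ≤ sqNorm v :=
  Finset.sum_nonneg fun i _ => sq_nonneg (v i)

lemma l1_nonneg (v : n → ℝ) : 0 ≤ l1 v :=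
  Finset.sum_nonneg fun i _ => abs_nonneg (v i)

lemma sqNorm_eq_zero {v : n → ℝ} (h : sqNorm v = 0) : v = 0 := by
  rw [sqNorm_eq_dotProduct] at h
  exact dotProduct_self_eq_zero.1 h

lemma dotProduct_sq_le (a b : n → ℝ) : (a ⬝ᵥ b) ^ 2 ≤ sqNorm a * sqNorm b := by
  simpa [dotProduct, sqNorm] using Finset.sum_mul_sq_le_sq_mul_sq Finset.univ a b

lemma sqNorm_mulVec (A : Matrix r n ℝ) (x : n → ℝ) :
    sqNorm (A *ᵥ x) = x ⬝ᵥ (Aᵀ * A) *ᵥ x := by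
  rw [sqNorm_eq_dotProduct, ← mulVec_mulVec, dotProduct_mulVec, ← mulVec_transpose,
    dotProduct_comm]

lemma sqNorm_sub (a b : n → ℝ) : sqNorm (a - b) = sqNorm a - 2 * (a ⬝ᵥ b) + sqNorm b := by
  simp only [sqNorm_eq_dotProduct, sub_dotProduct, dotProduct_sub, dotProduct_comm b a]
  ring

/-- An orthogonal projection does not increase the Euclidean norm. -/
lemma sqNorm_proj_le {P : Matrix n n ℝ} (hs : Pᵀ = P) (hi : P * P = P) (v : n → ℝ) :
    sqNorm (P *ᵥ v) ≤ sqNorm v := by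
  have h1 : sqNorm (P *ᵥ v) = v ⬝ᵥ P *ᵥ v := by rw [sqNorm_mulVec, hs, hi]
  have h2 := sqNorm_nonneg (v - P *ᵥ v)
  rw [sqNorm_sub] at h2
  linarith

variable [DecidableEq n]

/-- The orthogonal projection `I - A†A` onto the null space of `A`. -/
noncomputable def kerProj (A : Matrix r n ℝ) : Matrix n n ℝ := 1 - pinv A * A

lemma mul_pinv_mul (A : Matrix r n ℝ) : A * pinv A * A = A := (pinv_penrose A).1

lemma pinv_mul_pinv (A : Matrix r n ℝ) : pinv A * A * pinv A = pinv A := (pinv_penrose A).2.1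

lemma transpose_mul_pinv (A : Matrix r n ℝ) : (A * pinv A)ᵀ = A * pinv A :=
  (pinv_penrose A).2.2.1

lemma transpose_pinv_mul (A : Matrix r n ℝ) : (pinv A * A)ᵀ = pinv A * A :=
  (pinv_penrose A).2.2.2

lemma pinv_mul_idem (A : Matrix r n ℝ) : pinv A * A * (pinv A * A) = pinv A * A := by
  rw [← Matrix.mul_assoc, pinv_mul_pinv]

lemma mul_pinv_idem (A : Matrix r n ℝ) : A * pinv A * (A * pinv A) = A * pinv A := by
  rw [← Matrix.mul_assoc, mul_pinv_mul]

lemma kerProj_transpose (A : Matrix r n ℝ) : (kerProj A)ᵀ = kerProj A := by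
  rw [kerProj, transpose_sub, transpose_one, transpose_pinv_mul]

lemma kerProj_idem (A : Matrix r n ℝ) : kerProj A * kerProj A = kerProj A := by
  simp only [kerProj, Matrix.mul_sub, Matrix.sub_mul, Matrix.one_mul, Matrix.mul_one,
    pinv_mul_idem]
  simp

lemma mul_kerProj (A : Matrix r n ℝ) : A * kerProj A = 0 := by
  rw [kerProj, Matrix.mul_sub, ← Matrix.mul_assoc, mul_pinv_mul]
  simp

lemma trace_kerProj (A : Matrix r n ℝ) :
    (kerProj A).trace = Fintype.card n - (A * pinv A).trace := by
  rw [kerProj, trace_sub, trace_one, trace_mul_comm]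

lemma trace_kerProj_eq_sum_sq (A : Matrix r n ℝ) :
    (kerProj A).trace = ∑ i, ∑ j, kerProj A i j ^ 2 := by
  conv_lhs => rw [← kerProj_idem A]
  simp only [trace, diag_apply, mul_apply]
  refine Finset.sum_congr rfl fun i _ => Finset.sum_congr rfl fun j _ => ?_
  have : kerProj A j i = kerProj A i j := by
    conv_lhs => rw [← kerProj_transpose A]
    rfl
  rw [this, sq]

/-- Rank-nullity: the number of rows is at least the dimension minus the nullity. -/
lemma card_sub_trace_kerProj_le (A : Matrix r n ℝ) :
    (Fintype.card n : ℝ) - (kerProj A).trace ≤ Fintype.card r := by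
  classical
  rw [trace_kerProj, sub_sub_cancel]
  have h : ∀ j : r, (A * pinv A) j j ≤ 1 := by
    intro j
    have h1 : (A * pinv A) j j = sqNorm fun i => (A * pinv A) i j := by
      conv_lhs => rw [← mul_pinv_idem A]
      rw [mul_apply, sqNorm]
      refine Finset.sum_congr rfl fun i _ => ?_
      have : (A * pinv A) j i = (A * pinv A) i j := by
        conv_lhs => rw [← transpose_mul_pinv A]
        rfl
      rw [this, sq]
    have h2 : (A * pinv A) j j ^ 2 ≤ sqNorm fun i => (A * pinv A) i j :=
      Finset.single_le_sum (f := fun i => (A * pinv A) i j ^ 2) (fun i _ => sq_nonneg _)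
        (Finset.mem_univ j)
    nlinarith
  calc (A * pinv A).trace = ∑ j, (A * pinv A) j j := rfl
    _ ≤ ∑ _j : r, (1 : ℝ) := Finset.sum_le_sum fun j _ => h j
    _ = Fintype.card r := by simp

lemma sqrt_sqNorm_col_le_maxColNorm (A : Matrix r n ℝ) (j : r) :
    √(sqNorm fun i => pinv A i j) ≤ maxColNorm A :=
  le_ciSup (f := fun j => √(sqNorm fun i => pinv A i j)) (Set.finite_range _).bddAbove j

lemma maxColNorm_nonneg (A : Matrix r n ℝ) : 0 ≤ maxColNorm A :=
  Real.iSup_nonneg fun _ => Real.sqrt_nonneg _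

lemma tuningScale_nonneg (A : Matrix r n ℝ) : 0 ≤ tuningScale A :=
  mul_nonneg (maxColNorm_nonneg A) (Real.sqrt_nonneg _)

lemma maxColNorm_le {A : Matrix r n ℝ} {M : ℝ} (hM : 0 ≤ M)
    (h : ∀ j, sqNorm (fun i => pinv A i j) ≤ M ^ 2) : maxColNorm A ≤ M :=
  Real.iSup_le (fun j => Real.sqrt_le_iff.2 ⟨hM, h j⟩) hM

/-- For a right inverse `B` of `A` one has `A† = (A†A)B`, so the columns of `A†` are projections
of the columns of `B`. -/
lemma sqNorm_col_pinv_le_of_rightInverse [DecidableEq r] {A : Matrix r n ℝ} {B : Matrix n r ℝ}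
    (h : A * B = 1) (j : r) : sqNorm (fun i => pinv A i j) ≤ sqNorm (fun i => B i j) := by
  have e : (fun i => pinv A i j) = (pinv A * A) *ᵥ (fun i => B i j) := by
    have : pinv A = pinv A * A * B := by rw [Matrix.mul_assoc, h, Matrix.mul_one]
    funext i
    conv_lhs => rw [this]
    rfl
  rw [e]
  exact sqNorm_proj_le (transpose_pinv_mul A) (pinv_mul_idem A) _

lemma trace_kerProj_of_rightInverse [DecidableEq r] {A : Matrix r n ℝ} {B : Matrix n r ℝ}
    (h : A * B = 1) : (kerProj A).trace = Fintype.card n - Fintype.card r := by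
  have : A * pinv A = 1 := by
    calc A * pinv A = A * pinv A * (A * B) := by rw [h, Matrix.mul_one]
      _ = A * B := by rw [← Matrix.mul_assoc, mul_pinv_mul]
      _ = 1 := h
  rw [trace_kerProj, this, trace_one]

/-- The basic inequality: on the event that the penalty level dominates `‖(A†)ᵀε‖_∞`, the part of
the noise in the row space of `A` is absorbed by the penalty, and only its projection onto the null
space of `A` and the `ℓ₁` norm of `A β₀` contribute to the error. -/
lemma sqNorm_error_le {A : Matrix r n ℝ} {lam : ℝ} {β₀ ε b : n → ℝ}
    (hb : IsGenLasso A lam (β₀ + ε) b)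
    (hε : ∀ j, |(fun i => pinv A i j) ⬝ᵥ ε| ≤ lam) :
    sqNorm (b - β₀) ≤ 4 * sqNorm (kerProj A *ᵥ ε) + 8 * lam * l1 (A *ᵥ β₀) := by
  obtain ⟨d, hd⟩ : ∃ d, d = b - β₀ := ⟨_, rfl⟩
  rw [← hd]
  have h1 : 1 / 2 * sqNorm (ε - d) + lam * l1 (A *ᵥ b) ≤
      1 / 2 * sqNorm ε + lam * l1 (A *ᵥ β₀) := by
    have h : 1 / 2 * sqNorm (β₀ + ε - b) + lam * l1 (A *ᵥ b) ≤
      1 / 2 * sqNorm (β₀ + ε - β₀) + lam * l1 (A *ᵥ β₀) := hb (Set.mem_univ β₀)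
    have e1 : β₀ + ε - b = ε - d := by rw [hd]; abel
    have e2 : β₀ + ε - β₀ = ε := by abel
    rwa [e1, e2] at h
  rw [sqNorm_sub] at h1
  have h2 : ε ⬝ᵥ d = (kerProj A *ᵥ ε) ⬝ᵥ d + ((pinv A)ᵀ *ᵥ ε) ⬝ᵥ (A *ᵥ d) := by
    have e1 : (kerProj A *ᵥ ε) ⬝ᵥ d = ε ⬝ᵥ kerProj A *ᵥ d := by
      rw [dotProduct_mulVec, ← mulVec_transpose, kerProj_transpose]
    have e2 : ((pinv A)ᵀ *ᵥ ε) ⬝ᵥ (A *ᵥ d) = ε ⬝ᵥ (pinv A * A) *ᵥ d := by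
      rw [← mulVec_mulVec, mulVec_transpose, ← dotProduct_mulVec]
    rw [e1, e2, kerProj, sub_mulVec, one_mulVec, dotProduct_sub]
    ring
  have h3 : ((pinv A)ᵀ *ᵥ ε) ⬝ᵥ (A *ᵥ d) ≤ lam * (l1 (A *ᵥ b) + l1 (A *ᵥ β₀)) := by
    rw [l1, l1, ← Finset.sum_add_distrib, Finset.mul_sum, dotProduct]
    refine Finset.sum_le_sum fun j _ => ?_
    have e : (A *ᵥ d) j = (A *ᵥ b) j - (A *ᵥ β₀) j := by rw [hd, mulVec_sub]; rfl
    have hj : |((pinv A)ᵀ *ᵥ ε) j| ≤ lam := hε j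
    calc ((pinv A)ᵀ *ᵥ ε) j * (A *ᵥ d) j ≤ |((pinv A)ᵀ *ᵥ ε) j * (A *ᵥ d) j| := le_abs_self _
      _ = |((pinv A)ᵀ *ᵥ ε) j| * |(A *ᵥ d) j| := abs_mul _ _
      _ ≤ lam * (|(A *ᵥ b) j| + |(A *ᵥ β₀) j|) := by
        rw [e]
        exact mul_le_mul hj (abs_sub _ _) (abs_nonneg _) ((abs_nonneg _).trans hj)
  have h4 : (kerProj A *ᵥ ε) ⬝ᵥ d ≤ sqNorm (kerProj A *ᵥ ε) + 1 / 4 * sqNorm d := by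
    have h := dotProduct_sq_le (kerProj A *ᵥ ε) d
    have hx := sqNorm_nonneg (kerProj A *ᵥ ε)
    have hy := sqNorm_nonneg d
    refine (le_abs_self _).trans (abs_le_of_sq_le_sq (h.trans ?_) (by positivity))
    nlinarith [sq_nonneg (sqNorm (kerProj A *ᵥ ε) - 1 / 4 * sqNorm d)]
  linarith

end LinearAlgebra

/-! ### The Gaussian noise -/

section Noise

variable {n : ℕ} (σ : ℝ≥0)

instance : IsProbabilityMeasure (noise σ n) := by
  unfold noise; infer_instance

lemma iIndepFun_noise (a : Fin n → ℝ) :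
    iIndepFun (fun i (ε : Fin n → ℝ) => a i * ε i) (noise σ n) :=
  iIndepFun_pi (X := fun i x => a i * x) fun i => by fun_prop

lemma aemeasurable_eval_noise (i : Fin n) : AEMeasurable (fun ε => ε i) (noise σ n) :=
  (measurable_pi_apply i).aemeasurable

lemma map_eval_noise (i : Fin n) :
    (noise σ n).map (fun ε => ε i) = gaussianReal 0 (σ ^ 2) :=
  (measurePreserving_eval (fun _ : Fin n => gaussianReal 0 (σ ^ 2)) i).map_eq

lemma hasSubgaussianMGF_eval_noise (i : Fin n) :
    HasSubgaussianMGF (fun ε => ε i) (σ ^ 2) (noise σ n) := by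
  have h : HasSubgaussianMGF id (σ ^ 2) (gaussianReal 0 (σ ^ 2)) :=
    ⟨fun t => integrable_exp_mul_gaussianReal t, fun t => by
      rw [mgf_id_gaussianReal]; simp⟩
  rw [← map_eval_noise σ i] at h
  exact HasSubgaussianMGF.of_map (aemeasurable_eval_noise σ i) h

/-- A linear form in the noise has a sub-Gaussian upper tail. -/
lemma noise_real_le_dotProduct (a : Fin n → ℝ) {M s : ℝ} (hM : sqNorm a ≤ M ^ 2)
    (hs : 0 ≤ s) :
    (noise σ n).real {ε | s ≤ a ⬝ᵥ ε} ≤ Real.exp (-s ^ 2 / (2 * (σ ^ 2 * M ^ 2))) := by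
  have h := HasSubgaussianMGF.sum_of_iIndepFun (iIndepFun_noise σ a) (s := Finset.univ)
    (fun i _ => (hasSubgaussianMGF_eval_noise σ i).const_mul (a i))
  set c : ℝ≥0 := ∑ i, ⟨a i ^ 2, sq_nonneg (a i)⟩ * σ ^ 2 with hc
  have hcle : (c : ℝ) ≤ σ ^ 2 * M ^ 2 := by
    have : (c : ℝ) = σ ^ 2 * sqNorm a := by
      rw [hc, sqNorm, Finset.mul_sum]
      push_cast
      exact Finset.sum_congr rfl fun i _ => mul_comm _ _
    rw [this]
    gcongr
  have h' : HasSubgaussianMGF (fun ε : Fin n → ℝ => ∑ i, a i * ε i)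
      ⟨σ ^ 2 * M ^ 2, by positivity⟩ (noise σ n) :=
    ⟨h.integrable_exp_mul, fun t => (h.mgf_le t).trans (Real.exp_le_exp.2 (by
      change (c : ℝ) * t ^ 2 / 2 ≤ σ ^ 2 * M ^ 2 * t ^ 2 / 2
      gcongr))⟩
  exact h'.measure_ge_le hs

lemma memLp_eval_noise (i : Fin n) : MemLp (fun ε => ε i) 2 (noise σ n) :=
  (hasSubgaussianMGF_eval_noise σ i).memLp 2

lemma integral_dotProduct_sq_noise (a : Fin n → ℝ) :
    Integrable (fun ε => (a ⬝ᵥ ε) ^ 2) (noise σ n) ∧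
      ∫ ε, (a ⬝ᵥ ε) ^ 2 ∂(noise σ n) = σ ^ 2 * sqNorm a := by
  have hm : ∀ i ∈ Finset.univ, MemLp (fun ε => a i * ε i) 2 (noise σ n) :=
    fun i _ => (memLp_eval_noise σ i).const_mul (a i)
  have hs : MemLp (fun ε => a ⬝ᵥ ε) 2 (noise σ n) := by
    simpa [dotProduct] using memLp_finsetSum Finset.univ hm
  refine ⟨hs.integrable_sq, ?_⟩
  have hmean : ∀ i, ∫ ε, ε i ∂(noise σ n) = 0 := fun i => by
    have h := integral_map (μ := noise σ n) (φ := fun ε => ε i) (f := id)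
      (aemeasurable_eval_noise σ i) aestronglyMeasurable_id
    rw [map_eval_noise] at h
    simpa using h.symm
  have hzero : ∫ ε, a ⬝ᵥ ε ∂(noise σ n) = 0 := by
    simp only [dotProduct]
    rw [integral_finsetSum _ fun i hi => (hm i hi).integrable (by norm_num)]
    simp [integral_const_mul, hmean]
  have hvar : ∀ i, Var[fun ε => ε i; noise σ n] = σ ^ 2 := fun i => by
    have h := variance_map (μ := noise σ n) (Y := fun ε => ε i) (X := id)
      aemeasurable_id (aemeasurable_eval_noise σ i)
    rw [map_eval_noise, variance_id_gaussianReal] at h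
    simpa using h.symm
  rw [← variance_of_integral_eq_zero hs.aestronglyMeasurable.aemeasurable hzero]
  have h := IndepFun.variance_sum hm fun i _ j _ hij => (iIndepFun_noise σ a).indepFun hij
  have e : (∑ i, fun ε : Fin n → ℝ => a i * ε i) = fun ε => a ⬝ᵥ ε := by
    ext ε; simp [dotProduct]
  rw [e] at h
  rw [h, sqNorm, Finset.mul_sum]
  refine Finset.sum_congr rfl fun i _ => ?_
  rw [variance_const_mul, hvar, mul_comm]

/-- `E‖Qε‖² = σ² tr Q` for the projection `Q` onto the null space, and Markov's inequality. -/
lemma noise_real_kerProj_le {r : Type*} [Fintype r] (A : Matrix r (Fin n) ℝ) {t : ℝ}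
    (ht : 0 < t) :
    (noise σ n).real {ε | t ≤ sqNorm (kerProj A *ᵥ ε)} ≤ σ ^ 2 * (kerProj A).trace / t := by
  have hi : Integrable (fun ε => sqNorm (kerProj A *ᵥ ε)) (noise σ n) :=
    integrable_finsetSum _ fun i _ => (integral_dotProduct_sq_noise σ (kerProj A i)).1
  have h := mul_meas_ge_le_integral_of_nonneg (μ := noise σ n)
    (ae_of_all _ fun ε => sqNorm_nonneg (kerProj A *ᵥ ε)) hi t
  have e : ∫ ε, sqNorm (kerProj A *ᵥ ε) ∂(noise σ n) = σ ^ 2 * (kerProj A).trace := by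
    calc ∫ ε, sqNorm (kerProj A *ᵥ ε) ∂(noise σ n)
        = ∑ i, ∫ ε, (kerProj A i ⬝ᵥ ε) ^ 2 ∂(noise σ n) :=
          integral_finsetSum _ fun i _ => (integral_dotProduct_sq_noise σ (kerProj A i)).1
      _ = _ := by
          rw [trace_kerProj_eq_sum_sq, Finset.mul_sum]
          exact Finset.sum_congr rfl fun i _ => (integral_dotProduct_sq_noise σ _).2
  rw [e] at h
  rw [le_div_iff₀ ht, mul_comm]
  exact h

/-- Union bound for `‖(A†)ᵀε‖_∞`: since `c₁ > √2 σ`, the exponent is negative. -/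
lemma noise_real_pinv_le {r : Type*} [Fintype r] [Nonempty r] (A : Matrix r (Fin n) ℝ)
    (hσ : 0 < σ) {c₁ lam : ℝ} (hc₁ : 0 < c₁) (hlam : c₁ * tuningScale A ≤ lam) :
    (noise σ n).real {ε | ∃ j, lam < |(fun i => pinv A i j) ⬝ᵥ ε|} ≤
      2 * (Fintype.card r : ℝ) ^ (1 - c₁ ^ 2 / (2 * σ ^ 2)) := by
  have hr : (0 : ℝ) < Fintype.card r := by exact_mod_cast Fintype.card_pos
  have hr1 : (1 : ℝ) ≤ Fintype.card r := by exact_mod_cast Fintype.card_pos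
  have hlam0 : 0 ≤ lam := (mul_nonneg hc₁.le (tuningScale_nonneg A)).trans hlam
  set M := maxColNorm A with hM
  have hcol : ∀ j, sqNorm (fun i => pinv A i j) ≤ M ^ 2 := fun j =>
    (Real.sqrt_le_left (maxColNorm_nonneg A)).1 (sqrt_sqNorm_col_le_maxColNorm A j)
  -- If `M(A) = 0`, the Gaussian bound below degenerates to `exp 0`, but all linear forms vanish.
  rcases (maxColNorm_nonneg A).eq_or_lt with h0 | hpos
  · have : {ε : Fin n → ℝ | ∃ j, lam < |(fun i => pinv A i j) ⬝ᵥ ε|} = ∅ := by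
      ext ε
      simp only [Set.mem_ofPred_eq, Set.mem_empty_iff_false, iff_false, not_exists, not_lt]
      intro j
      have hz : (fun i => pinv A i j) = 0 := sqNorm_eq_zero <| le_antisymm
        ((hcol j).trans (by rw [hM, ← h0]; simp)) (sqNorm_nonneg _)
      rw [hz]
      simpa using hlam0
    rw [this]
    simp only [measureReal_empty]
    positivity
  · have hexp : Real.exp (-lam ^ 2 / (2 * (σ ^ 2 * M ^ 2))) ≤
        (Fintype.card r : ℝ) ^ (-(c₁ ^ 2 / (2 * σ ^ 2))) := by
      rw [Real.rpow_def_of_pos hr, Real.exp_le_exp]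
      have hσ' : (0 : ℝ) < σ := hσ
      have hlog : 0 ≤ Real.log (Fintype.card r) := Real.log_nonneg hr1
      have h1 : (c₁ * tuningScale A) ^ 2 ≤ lam ^ 2 :=
        pow_le_pow_left₀ (mul_nonneg hc₁.le (tuningScale_nonneg A)) hlam 2
      have h2 : (c₁ * tuningScale A) ^ 2 = c₁ ^ 2 * M ^ 2 * Real.log (Fintype.card r) := by
        rw [tuningScale, mul_pow, mul_pow, Real.sq_sqrt hlog]; ring
      rw [h2] at h1
      rw [neg_div, mul_neg, neg_le_neg_iff, le_div_iff₀ (by positivity)]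
      calc _ = c₁ ^ 2 * M ^ 2 * Real.log (Fintype.card r) := by field_simp
        _ ≤ _ := h1
    have hsub : {ε : Fin n → ℝ | ∃ j, lam < |(fun i => pinv A i j) ⬝ᵥ ε|} ⊆
        ⋃ j, ({ε | lam ≤ (fun i => pinv A i j) ⬝ᵥ ε} ∪
          {ε | lam ≤ (-fun i => pinv A i j) ⬝ᵥ ε}) := by
      rintro ε ⟨j, hj⟩
      refine Set.mem_iUnion.2 ⟨j, ?_⟩
      rcases lt_abs.1 hj with h | h
      · exact Or.inl h.le
      · exact Or.inr (by simpa using h.le)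
    calc _ ≤ (noise σ n).real (⋃ j, ({ε | lam ≤ (fun i => pinv A i j) ⬝ᵥ ε} ∪
          {ε | lam ≤ (-fun i => pinv A i j) ⬝ᵥ ε})) := measureReal_mono hsub
      _ ≤ ∑ j, (noise σ n).real ({ε | lam ≤ (fun i => pinv A i j) ⬝ᵥ ε} ∪
          {ε | lam ≤ (-fun i => pinv A i j) ⬝ᵥ ε}) := measureReal_iUnion_fintype_le _
      _ ≤ ∑ _j : r, 2 * (Fintype.card r : ℝ) ^ (-(c₁ ^ 2 / (2 * σ ^ 2))) := by
        refine Finset.sum_le_sum fun j _ => (measureReal_union_le _ _).trans ?_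
        have hneg : sqNorm (-fun i => pinv A i j) ≤ M ^ 2 := by
          simpa [sqNorm] using hcol j
        have h1 := (noise_real_le_dotProduct σ _ (hcol j) hlam0).trans hexp
        have h2 := (noise_real_le_dotProduct σ _ hneg hlam0).trans hexp
        linarith
      _ = _ := by
        rw [Finset.sum_const, Finset.card_univ, nsmul_eq_mul, sub_eq_add_neg,
          Real.rpow_add hr, Real.rpow_one]
        ring

/-- The error bound for the generalized lasso, uniformly over all problems of size at least `N`
with nullity at most `κ` and tuning level at most `K n ρ`: the normalized squared error is of order
`1 / n + ρ ‖A β₀‖₁` with high probability. -/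
theorem genLasso_error_uniform (hσ : 0 < σ) {c₁ c₂ : ℝ} (hc₁ : √2 * (σ : ℝ) < c₁) (κ : ℕ)
    {K η : ℝ} (hη : 0 < η) :
    ∃ C : ℝ, ∃ N : ℕ, ∀ (n : ℕ), N ≤ n → ∀ (r : Type) [Fintype r] (A : Matrix r (Fin n) ℝ)
      (lam ρ : ℝ) (β₀ : Fin n → ℝ) (b : (Fin n → ℝ) → Fin n → ℝ),
      (kerProj A).trace ≤ κ → 0 ≤ ρ → tuningScale A ≤ K * (n * ρ) →
      c₁ * tuningScale A ≤ lam → lam ≤ c₂ * tuningScale A →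
      (∀ y, IsGenLasso A lam y (b y)) →
      noise σ n {ε | C * |1 / (n : ℝ) + ρ * l1 (A *ᵥ β₀)| <
        |sqNorm (b (β₀ + ε) - β₀) / n|} ≤ ENNReal.ofReal η := by
  have hσ' : (0 : ℝ) < σ := hσ
  have hc₁0 : 0 < c₁ := lt_trans (by positivity) hc₁
  set a : ℝ := c₁ ^ 2 / (2 * σ ^ 2) - 1 with ha
  have ha0 : 0 < a := by
    rw [ha, sub_pos, lt_div_iff₀ (by positivity), one_mul]
    calc 2 * (σ : ℝ) ^ 2 = (√2 * σ) ^ 2 := by rw [mul_pow, Real.sq_sqrt (by norm_num)]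
      _ < c₁ ^ 2 := by gcongr
  have hlim : Tendsto (fun m : ℕ => 2 * ((m : ℝ) ^ (-a))) atTop (nhds (2 * 0)) :=
    ((tendsto_rpow_neg_atTop ha0).comp tendsto_natCast_atTop_atTop).const_mul 2
  obtain ⟨N, hN⟩ := eventually_atTop.1
    (hlim.eventually_lt_const (u := η / 2) (by simpa using half_pos hη))
  -- With this level, Markov's inequality for the null space part costs at most `η / 2`.
  set t : ℝ := 2 * σ ^ 2 * (κ + 1) / η with ht
  have ht0 : 0 < t := by positivity
  refine ⟨max (4 * t) (8 * |c₂| * K), N + κ + 1, fun n hn r _ A lam ρ β₀ b htr hρ hscale hl1 hl2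
    hb => ?_⟩
  set C := max (4 * t) (8 * |c₂| * K) with hC
  have hn0 : (0 : ℝ) < n := by
    have : 0 < n := by omega
    exact_mod_cast this
  -- Bounded nullity forces the number of rows to grow with `n`, so that the union bound is small.
  have hcard : ((N + 1 : ℕ) : ℝ) ≤ Fintype.card r := by
    have h := card_sub_trace_kerProj_le A
    rw [Fintype.card_fin] at h
    have h2 : ((N + κ + 1 : ℕ) : ℝ) ≤ n := by exact_mod_cast hn
    push_cast at h2 ⊢
    linarith
  have hcard' : N + 1 ≤ Fintype.card r := by exact_mod_cast hcard
  have : Nonempty r := Fintype.card_pos_iff.1 (by omega)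
  have hL := l1_nonneg (A *ᵥ β₀)
  have hS := tuningScale_nonneg A
  have hsub : {ε : Fin n → ℝ | C * |1 / (n : ℝ) + ρ * l1 (A *ᵥ β₀)| <
      |sqNorm (b (β₀ + ε) - β₀) / n|} ⊆
      {ε | ∃ j, lam < |(fun i => pinv A i j) ⬝ᵥ ε|} ∪ {ε | t ≤ sqNorm (kerProj A *ᵥ ε)} := by
    intro ε hε
    by_contra hcon
    simp only [Set.mem_union, Set.mem_ofPred_eq, not_or, not_exists, not_lt, not_le] at hcon hε
    have h := sqNorm_error_le (hb (β₀ + ε)) hcon.1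
    rw [abs_of_nonneg (by positivity), abs_of_nonneg (div_nonneg (sqNorm_nonneg _) hn0.le),
      lt_div_iff₀ hn0] at hε
    have e : C * (1 / (n : ℝ) + ρ * l1 (A *ᵥ β₀)) * n =
        C + C * (n * ρ * l1 (A *ᵥ β₀)) := by field_simp
    rw [e] at hε
    have h1 : 4 * t ≤ C := le_max_left _ _
    have h2 : lam ≤ |c₂| * (K * (n * ρ)) :=
      calc lam ≤ c₂ * tuningScale A := hl2
        _ ≤ |c₂| * tuningScale A := by gcongr; exact le_abs_self _
        _ ≤ _ := by gcongr
    have h3 : 8 * lam * l1 (A *ᵥ β₀) ≤ C * (n * ρ * l1 (A *ᵥ β₀)) :=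
      calc 8 * lam * l1 (A *ᵥ β₀) ≤ 8 * (|c₂| * (K * (n * ρ))) * l1 (A *ᵥ β₀) := by gcongr
        _ = 8 * |c₂| * K * (n * ρ * l1 (A *ᵥ β₀)) := by ring
        _ ≤ _ := by gcongr; exact le_max_right _ _
    linarith [hcon.2]
  refine (measure_mono hsub).trans ?_
  rw [← ofReal_measureReal]
  refine ENNReal.ofReal_le_ofReal ((measureReal_union_le _ _).trans ?_)
  have hp1 := noise_real_pinv_le σ A hσ hc₁0 hl1
  have hp2 := noise_real_kerProj_le σ A ht0
  have e1 : 1 - c₁ ^ 2 / (2 * (σ : ℝ) ^ 2) = -a := by rw [ha]; ring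
  rw [e1] at hp1
  have hp1' := hN (Fintype.card r) (by omega)
  have hp2' : σ ^ 2 * (kerProj A).trace / t ≤ η / 2 := by
    rw [div_le_iff₀ ht0, ht]
    have : (kerProj A).trace ≤ κ + 1 := by linarith
    calc σ ^ 2 * (kerProj A).trace ≤ σ ^ 2 * (κ + 1) := by gcongr
      _ = η / 2 * (2 * σ ^ 2 * (κ + 1) / η) := by field_simp
  linarith

end Noise

/-! ### Univariate difference operators -/

section Univariate

/-- The summation operator, with entry `1` where the row index exceeds the column index: a right
inverse of the first difference operator. -/
def cumSum (m : ℕ) : Matrix (Fin m) (Fin (m - 1)) ℝ :=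
  fun i j => if (j : ℕ) < i then 1 else 0

lemma firstDiff_mul_cumSum (m : ℕ) : firstDiff m * cumSum m = 1 := by
  ext i l
  have hi : (i : ℕ) + 1 < m := by omega
  have e : ∀ j : Fin m, firstDiff m i j * cumSum m j l =
      (if j = ⟨i + 1, hi⟩ then cumSum m j l else 0) -
        (if j = ⟨i, by omega⟩ then cumSum m j l else 0) := by
    intro j
    simp only [firstDiff, Fin.ext_iff]
    by_cases h1 : (j : ℕ) = i
    · have h2 : (j : ℕ) ≠ i + 1 := by omega
      simp [h1]
    · simp [h1]
  rw [mul_apply, Finset.sum_congr rfl fun j _ => e j, Finset.sum_sub_distrib,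
    Finset.sum_ite_eq' Finset.univ, Finset.sum_ite_eq' Finset.univ, one_apply]
  simp only [Finset.mem_univ, if_true, cumSum, Fin.ext_iff]
  rcases lt_trichotomy (i : ℕ) l with h | h | h
  · rw [if_neg (by omega), if_neg (by omega), if_neg (by omega), sub_zero]
  · rw [if_pos (by omega), if_neg (by omega), if_pos h, sub_zero]
  · rw [if_pos (by omega), if_pos (by omega), if_neg (by omega), sub_self]

/-- The iterated summation operator, a right inverse of `univDiff n j`. -/
def univSum (n : ℕ) : (j : ℕ) → Matrix (Fin n) (Fin (n - j)) ℝ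
  | 0 => (1 : Matrix (Fin n) (Fin n) ℝ)
  | j + 1 => univSum n j * cumSum (n - j)

lemma univDiff_mul_univSum (n j : ℕ) : univDiff n j * univSum n j = 1 := by
  induction j with
  | zero => exact Matrix.mul_one _
  | succ j ih =>
    change firstDiff (n - j) * univDiff n j * (univSum n j * cumSum (n - j)) = 1
    rw [Matrix.mul_assoc, ← Matrix.mul_assoc (univDiff n j), ih, Matrix.one_mul]
    exact firstDiff_mul_cumSum _

lemma abs_cumSum_le (m : ℕ) (i : Fin m) (j : Fin (m - 1)) : |cumSum m i j| ≤ 1 := by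
  unfold cumSum; split_ifs <;> simp

lemma abs_univSum_le (n k : ℕ) (i : Fin n) (j : Fin (n - (k + 1))) :
    |univSum n (k + 1) i j| ≤ (n : ℝ) ^ k := by
  induction k with
  | zero =>
    have : univSum n (0 + 1) = cumSum n := Matrix.one_mul _
    rw [this, pow_zero]
    exact abs_cumSum_le n i j
  | succ k ih =>
    change |(univSum n (k + 1) * cumSum (n - (k + 1))) i j| ≤ _
    rw [mul_apply]
    calc |∑ l, univSum n (k + 1) i l * cumSum (n - (k + 1)) l j|
        ≤ ∑ l, |univSum n (k + 1) i l * cumSum (n - (k + 1)) l j| :=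
          Finset.abs_sum_le_sum_abs _ _
      _ ≤ ∑ _l : Fin (n - (k + 1)), (n : ℝ) ^ k := by
        refine Finset.sum_le_sum fun l _ => ?_
        rw [abs_mul]
        calc _ ≤ (n : ℝ) ^ k * 1 := mul_le_mul (ih l) (abs_cumSum_le _ _ _) (abs_nonneg _)
              (by positivity)
          _ = _ := mul_one _
      _ = ((n - (k + 1) : ℕ) : ℝ) * (n : ℝ) ^ k := by simp
      _ ≤ n * (n : ℝ) ^ k := by
        gcongr
        omega
      _ = _ := by ring

lemma trace_kerProj_univDiff {n k : ℕ} (h : k + 1 ≤ n) :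
    (kerProj (univDiff n (k + 1))).trace = (k + 1 : ℕ) := by
  rw [trace_kerProj_of_rightInverse (univDiff_mul_univSum n (k + 1)), Fintype.card_fin,
    Fintype.card_fin, Nat.cast_sub h]
  ring

lemma maxColNorm_univDiff_le (n k : ℕ) :
    maxColNorm (univDiff n (k + 1)) ≤ (n : ℝ) ^ k * √n := by
  refine maxColNorm_le (by positivity) fun j => ?_
  refine (sqNorm_col_pinv_le_of_rightInverse (univDiff_mul_univSum n (k + 1)) j).trans ?_
  calc ∑ i, univSum n (k + 1) i j ^ 2 ≤ ∑ _i : Fin n, ((n : ℝ) ^ k) ^ 2 := by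
        refine Finset.sum_le_sum fun i _ => ?_
        rw [← sq_abs]
        exact pow_le_pow_left₀ (abs_nonneg _) (abs_univSum_le n k i j) 2
    _ = ((n : ℝ) ^ k * √n) ^ 2 := by
        rw [mul_pow, Real.sq_sqrt (Nat.cast_nonneg n)]
        simp [mul_comm]

lemma tuningScale_univDiff_le {n k : ℕ} (h : k + 1 < n) :
    tuningScale (univDiff n (k + 1)) ≤ 1 * (n * (√(Real.log n / n) * (n : ℝ) ^ k)) := by
  have hn : (0 : ℝ) < n := by exact_mod_cast (by omega : 0 < n)
  have hr : (0 : ℝ) < (n - (k + 1) : ℕ) := by exact_mod_cast (by omega : 0 < n - (k + 1))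
  rw [tuningScale, Fintype.card_fin]
  calc _ ≤ (n : ℝ) ^ k * √n * √(Real.log n) := by
        gcongr
        · exact maxColNorm_univDiff_le n k
        · omega
    _ = _ := by
        rw [Real.sqrt_div' _ hn.le]
        have h0 : √(n : ℝ) ≠ 0 := (Real.sqrt_pos.2 hn).ne'
        field_simp
        rw [Real.sq_sqrt hn.le, mul_comm]

end Univariate

/-! ### Graph difference operators under a spectral gap -/

section Graph

variable {n : ℕ} {G : SimpleGraph (Fin n)}

/-- `G` has Laplacian spectral gap at least `g`: `g‖x‖² ≤ xᵀLx` for all `x` of zero mean, where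
`L` is the Laplacian and `xᵀLx = ‖Δ^{(1)}x‖²`. -/
def HasGap (G : SimpleGraph (Fin n)) (g : ℝ) : Prop :=
  ∀ x : Fin n → ℝ, ∑ i, x i = 0 → g * sqNorm x ≤ sqNorm (incidence G *ᵥ x)

lemma incidence_mulVec_apply (x : Fin n → ℝ) (e : Edge G) :
    (incidence G *ᵥ x) e = x e.1.2 - x e.1.1 := by
  have hne : e.1.1 ≠ e.1.2 := e.2.1.ne
  have h : ∀ v, incidence G e v * x v =
      (if v = e.1.2 then x v else 0) - (if v = e.1.1 then x v else 0) := by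
    intro v
    by_cases h1 : v = e.1.1
    · have h2 : v ≠ e.1.2 := h1 ▸ hne
      simp [incidence, h1, hne]
    · simp [incidence, h1]
  simp only [mulVec, dotProduct]
  rw [Finset.sum_congr rfl fun v _ => h v, Finset.sum_sub_distrib]
  simp

lemma incidence_mulVec_one : incidence G *ᵥ (fun _ => (1 : ℝ)) = 0 := by
  funext e
  rw [incidence_mulVec_apply]
  simp

lemma graphDiff_mulVec_one (k : ℕ) : graphDiff G k *ᵥ (fun _ => (1 : ℝ)) = 0 := by
  induction k with
  | zero => exact incidence_mulVec_one
  | succ k ih =>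
    change (graphStep G k * graphDiff G k) *ᵥ _ = 0
    rw [← mulVec_mulVec, ih, mulVec_zero]

lemma graphDiff_add_two (k : ℕ) :
    graphDiff G (k + 2) = graphDiff G k * ((incidence G)ᵀ * incidence G) := by
  induction k with
  | zero => rfl
  | succ k ih =>
    -- The row index types of order `k + 2` and `k`, and the factors leading on from them, agree
    -- definitionally.
    exact (congrArg (fun M : Matrix (GraphRow G k) (Fin n) ℝ => graphStep G k * M) ih).trans
      (Matrix.mul_assoc _ _ _).symm

lemma sum_laplacian_mulVec (x : Fin n → ℝ) :
    ∑ i, (((incidence G)ᵀ * incidence G) *ᵥ x) i = 0 := by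
  have : ∑ i, (((incidence G)ᵀ * incidence G) *ᵥ x) i =
      (fun _ => (1 : ℝ)) ⬝ᵥ (((incidence G)ᵀ * incidence G) *ᵥ x) := by simp [dotProduct]
  rw [this, ← mulVec_mulVec, dotProduct_mulVec, vecMul_transpose, incidence_mulVec_one,
    zero_dotProduct]

/-- A spectral gap of the Laplacian controls the Laplacian itself from below. -/
lemma HasGap.sq_mul_sqNorm_le {g : ℝ} (hg : 0 < g) (h : HasGap G g) {x : Fin n → ℝ}
    (hx : ∑ i, x i = 0) :
    g ^ 2 * sqNorm x ≤ sqNorm (((incidence G)ᵀ * incidence G) *ᵥ x) := by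
  have h1 := h x hx
  rw [sqNorm_mulVec] at h1
  have h2 := dotProduct_sq_le x (((incidence G)ᵀ * incidence G) *ᵥ x)
  rcases (sqNorm_nonneg x).eq_or_lt with h0 | hpos
  · rw [← h0, mul_zero]
    exact sqNorm_nonneg _
  · have h3 : (g * sqNorm x) ^ 2 ≤ (x ⬝ᵥ ((incidence G)ᵀ * incidence G) *ᵥ x) ^ 2 :=
      pow_le_pow_left₀ (by positivity) h1 2
    refine le_of_mul_le_mul_left ?_ hpos
    calc _ = (g * sqNorm x) ^ 2 := by ring
      _ ≤ _ := h3.trans h2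

/-- Since `‖Δ^{(k+1)}x‖² = xᵀL^{k+1}x`, the gap enters with the power `k + 1`. -/
lemma HasGap.pow_mul_sqNorm_le {g : ℝ} (hg : 0 < g) (h : HasGap G g) (k : ℕ) {x : Fin n → ℝ}
    (hx : ∑ i, x i = 0) : g ^ (k + 1) * sqNorm x ≤ sqNorm (graphDiff G k *ᵥ x) := by
  induction k using Nat.twoStepInduction generalizing x with
  | zero => rw [zero_add, pow_one]; exact h x hx
  | one => exact h.sq_mul_sqNorm_le hg hx
  | more k ih _ =>
    have e : graphDiff G (k + 2) *ᵥ x =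
        graphDiff G k *ᵥ (((incidence G)ᵀ * incidence G) *ᵥ x) := by
      rw [graphDiff_add_two]
      exact (mulVec_mulVec _ _ _).symm
    rw [e]
    calc g ^ (k + 2 + 1) * sqNorm x = g ^ (k + 1) * (g ^ 2 * sqNorm x) := by ring
      _ ≤ g ^ (k + 1) * sqNorm (((incidence G)ᵀ * incidence G) *ᵥ x) := by
        gcongr
        exact h.sq_mul_sqNorm_le hg hx
      _ ≤ _ := ih (sum_laplacian_mulVec x)

lemma pinv_mul_graphDiff_mulVec_one (k : ℕ) :
    (pinv (graphDiff G k) * graphDiff G k) *ᵥ (fun _ => (1 : ℝ)) = 0 := by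
  rw [← mulVec_mulVec, graphDiff_mulVec_one, mulVec_zero]

/-- Under a spectral gap the null space of `Δ^{(k+1)}` consists of the constant vectors. -/
lemma HasGap.trace_kerProj {g : ℝ} (hg : 0 < g) (h : HasGap G g) (k : ℕ) (hn : 0 < n) :
    (kerProj (graphDiff G k)).trace = 1 := by
  set Q := kerProj (graphDiff G k) with hQ
  have hn' : (n : ℝ) ≠ 0 := by exact_mod_cast hn.ne'
  have hcol : ∀ i j, Q i j = (∑ l, Q l j) / n := by
    intro i j
    set m := (∑ l, Q l j) / n with hm
    set x : Fin n → ℝ := fun i => Q i j - m with hx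
    have hsum : ∑ i, x i = 0 := by
      simp only [hx, Finset.sum_sub_distrib, Finset.sum_const, Finset.card_univ,
        Fintype.card_fin, nsmul_eq_mul, hm]
      field_simp
      ring
    have hA : graphDiff G k *ᵥ x = 0 := by
      have e : x = (fun i => Q i j) - m • (fun _ => (1 : ℝ)) := by
        funext i; simp [hx]
      rw [e, mulVec_sub, mulVec_smul, graphDiff_mulVec_one, smul_zero, sub_zero]
      have := mul_kerProj (graphDiff G k)
      funext a
      exact congrFun (congrFun this a) j
    have h1 := h.pow_mul_sqNorm_le hg k hsum
    rw [hA] at h1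
    have h2 : sqNorm x = 0 := by
      have h3 : sqNorm (0 : GraphRow G k → ℝ) = 0 := by simp [sqNorm]
      rw [h3] at h1
      have h4 : 0 < g ^ (k + 1) := by positivity
      nlinarith [sqNorm_nonneg x]
    have := congrFun (sqNorm_eq_zero h2) i
    simpa [hx, sub_eq_zero] using this
  have hone : Q *ᵥ (fun _ => (1 : ℝ)) = fun _ => 1 := by
    rw [hQ, kerProj, sub_mulVec, one_mulVec, pinv_mul_graphDiff_mulVec_one, sub_zero]
  have h1 := congrFun hone ⟨0, hn⟩
  calc Q.trace = ∑ j, Q j j := rfl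
    _ = ∑ j, Q ⟨0, hn⟩ j := Finset.sum_congr rfl fun j _ => by rw [hcol j j, hcol ⟨0, hn⟩ j]
    _ = 1 := by simpa [mulVec, dotProduct] using h1

lemma HasGap.maxColNorm_graphDiff_le {g : ℝ} (hg : 0 < g) (h : HasGap G g) (k : ℕ) :
    maxColNorm (graphDiff G k) ≤ (√(g ^ (k + 1)))⁻¹ := by
  classical
  have hgk : 0 < g ^ (k + 1) := by positivity
  refine maxColNorm_le (by positivity) fun j => ?_
  set A := graphDiff G k with hA
  set u : Fin n → ℝ := fun i => pinv A i j with hu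
  have hAu : pinv A *ᵥ (Pi.single j 1) = u := by
    funext i; simp [hu]
  have hproj : (pinv A * A) *ᵥ u = u := by
    rw [← hAu, mulVec_mulVec, pinv_mul_pinv]
  have hsum : ∑ i, u i = 0 := by
    have : ∑ i, u i = (fun _ => (1 : ℝ)) ⬝ᵥ u := by simp [dotProduct]
    rw [this, ← hproj, dotProduct_mulVec, ← mulVec_transpose, transpose_pinv_mul,
      pinv_mul_graphDiff_mulVec_one, zero_dotProduct]
  have h1 := h.pow_mul_sqNorm_le hg k hsum
  have h2 : sqNorm (A *ᵥ u) ≤ 1 := by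
    rw [← hAu, mulVec_mulVec]
    refine (sqNorm_proj_le (transpose_mul_pinv A) (mul_pinv_idem A) _).trans_eq ?_
    simp [sqNorm, Pi.single_apply]
  rw [inv_pow, Real.sq_sqrt hgk.le, ← one_div, le_div_iff₀ hgk, mul_comm]
  exact h1.trans h2

lemma card_graphRow_le (k : ℕ) : Fintype.card (GraphRow G k) ≤ n ^ 2 := by
  induction k using Nat.twoStepInduction with
  | zero =>
    change Fintype.card (Edge G) ≤ n ^ 2
    calc Fintype.card (Edge G) ≤ Fintype.card (Fin n × Fin n) :=
          Fintype.card_le_of_injective (fun e : Edge G => e.1) Subtype.val_injective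
      _ = n ^ 2 := by simp [sq]
  | one =>
    change Fintype.card (Fin n) ≤ n ^ 2
    rw [Fintype.card_fin]
    exact Nat.le_self_pow (by norm_num) n
  | more k ih _ => exact ih

/-- If the spectral gap is of the order of `d`, then `M(Δ^{(k+1)})` is at most of the order of
`d^{-(k+1)/2}`. -/
lemma HasGap.tuningScale_graphDiff_le {c d : ℝ} (hc : 0 < c) (hd : 1 ≤ d)
    (h : HasGap G (c * d)) (k : ℕ) (hn : 0 < n) :
    tuningScale (graphDiff G k) ≤ (√(c ^ (k + 1)))⁻¹ * √2 *
      (n * (√(Real.log (n * d)) / (n * d ^ (((k : ℝ) + 1) / 2)))) := by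
  have hd0 : 0 < d := by linarith
  have hn' : (0 : ℝ) < n := by exact_mod_cast hn
  have hn1 : (1 : ℝ) ≤ n := by exact_mod_cast hn
  have hlog : √(Real.log (Fintype.card (GraphRow G k))) ≤ √2 * √(Real.log (n * d)) := by
    rw [← Real.sqrt_mul (by norm_num)]
    refine Real.sqrt_le_sqrt ?_
    rcases Nat.eq_zero_or_pos (Fintype.card (GraphRow G k)) with h0 | h0
    · rw [h0]
      simp only [Nat.cast_zero, Real.log_zero]
      exact mul_nonneg (by norm_num) (Real.log_nonneg (one_le_mul_of_one_le_of_one_le hn1 hd))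
    · have h1 : ((Fintype.card (GraphRow G k) : ℕ) : ℝ) ≤ (n : ℝ) ^ 2 := by
        exact_mod_cast card_graphRow_le k
      calc Real.log (Fintype.card (GraphRow G k)) ≤ Real.log ((n : ℝ) ^ 2) :=
            Real.log_le_log (by exact_mod_cast h0) h1
        _ = 2 * Real.log n := by rw [Real.log_pow]; norm_num
        _ ≤ 2 * Real.log (n * d) := by
            have : (n : ℝ) ≤ n * d := le_mul_of_one_le_right hn'.le hd
            gcongr
  have hpow : d ^ (((k : ℝ) + 1) / 2) = √(d ^ (k + 1)) := by
    rw [Real.sqrt_eq_rpow, ← Real.rpow_natCast, ← Real.rpow_mul hd0.le]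
    congr 1
    push_cast
    ring
  have hs : 0 < √(d ^ (k + 1)) := by positivity
  have hs' : 0 < √(c ^ (k + 1)) := by positivity
  calc tuningScale (graphDiff G k)
      ≤ (√((c * d) ^ (k + 1)))⁻¹ * (√2 * √(Real.log (n * d))) :=
        mul_le_mul (h.maxColNorm_graphDiff_le (by positivity) k) hlog (Real.sqrt_nonneg _)
          (by positivity)
    _ = _ := by
        rw [mul_pow, Real.sqrt_mul (by positivity), hpow]
        field_simp

/-- Twice the squared norm of `Δ^{(1)}x` as a sum over ordered pairs of vertices. -/
lemma two_mul_sqNorm_incidence_mulVec [DecidableRel G.Adj] (x : Fin n → ℝ) :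
    2 * sqNorm (incidence G *ᵥ x) =
      ∑ i, ∑ j, (if G.Adj i j then (x i - x j) ^ 2 else 0) := by
  have h1 : sqNorm (incidence G *ᵥ x) =
      ∑ i, ∑ j, (if i < j ∧ G.Adj i j then (x i - x j) ^ 2 else 0) := by
    rw [← Finset.sum_product', Finset.univ_product_univ, ← Finset.sum_filter]
    rw [sqNorm]
    refine Finset.sum_bij (fun (e : Edge G) _ => e.1) (fun e _ => ?_)
      (fun e _ f _ hef => Subtype.ext hef) (fun p hp => ?_) (fun e _ => ?_)
    · simpa using e.2
    · exact ⟨⟨p, by simpa using hp⟩, Finset.mem_univ _, rfl⟩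
    · rw [incidence_mulVec_apply]; ring
  have h2 : ∑ i, ∑ j, (if i < j ∧ G.Adj i j then (x i - x j) ^ 2 else 0) =
      ∑ i, ∑ j, (if j < i ∧ G.Adj i j then (x i - x j) ^ 2 else 0) := by
    rw [Finset.sum_comm]
    refine Finset.sum_congr rfl fun i _ => Finset.sum_congr rfl fun j _ => ?_
    simp only [G.adj_comm i j, sub_sq_comm (x j) (x i)]
  calc 2 * sqNorm (incidence G *ᵥ x)
      = ∑ i, ∑ j, (if i < j ∧ G.Adj i j then (x i - x j) ^ 2 else 0) +
          ∑ i, ∑ j, (if j < i ∧ G.Adj i j then (x i - x j) ^ 2 else 0) := by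
        rw [← h2, ← h1, two_mul]
    _ = _ := by
        simp only [← Finset.sum_add_distrib]
        refine Finset.sum_congr rfl fun i _ => Finset.sum_congr rfl fun j _ => ?_
        rcases lt_trichotomy i j with h | h | h
        · simp [h, h.not_gt]
        · simp [h]
        · simp [h, h.not_gt]

end Graph

/-! ### Ramanujan graphs -/

section Ramanujan

variable {n : ℕ} {G : SimpleGraph (Fin n)}

lemma sqNorm_incidence_mulVec_eq [DecidableRel G.Adj] (x : Fin n → ℝ) :
    sqNorm (incidence G *ᵥ x) = toLinearMap₂' ℝ (G.lapMatrix ℝ) x x := by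
  rw [SimpleGraph.lapMatrix_toLinearMap₂', ← two_mul_sqNorm_incidence_mulVec]
  ring

lemma sqNorm_incidence_mulVec_of_regular [DecidableRel G.Adj] {d : ℕ}
    (hd : G.IsRegularOfDegree d) (x : Fin n → ℝ) :
    sqNorm (incidence G *ᵥ x) = d * sqNorm x - x ⬝ᵥ (G.adjMatrix ℝ *ᵥ x) := by
  rw [sqNorm_incidence_mulVec_eq, toLinearMap₂'_apply', SimpleGraph.lapMatrix, sub_mulVec,
    dotProduct_sub, SimpleGraph.dotProduct_mulVec_degMatrix, sqNorm, Finset.mul_sum]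
  simp only [hd.degree_eq]
  congr 1
  exact Finset.sum_congr rfl fun i _ => by ring

lemma two_mul_sqrt_sub_one_le {d : ℝ} (hd : 3 ≤ d) : 2 * √(d - 1) ≤ 19 / 20 * d := by
  have h : √(d - 1) ≤ 19 / 40 * d := Real.sqrt_le_iff.2 ⟨by linarith, by nlinarith⟩
  linarith

/-- A Ramanujan graph of degree `d ≥ 3` has spectral gap of order `d`: in an eigenbasis of the
adjacency matrix, the eigenvectors of the eigenvalue `d` are constant by connectedness, and all
other eigenvalues are at most `2√(d-1) ≤ 0.95 d`. -/
lemma IsRamanujan.hasGap {d : ℕ} (hd : 3 ≤ d) (h : IsRamanujan G d) :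
    HasGap G (1 / 20 * (d : ℝ)) := by
  classical
  obtain ⟨hconn, hreg, hev⟩ := h
  have hreg' : G.IsRegularOfDegree d := by convert hreg
  have hdR : (3 : ℝ) ≤ d := by exact_mod_cast hd
  intro x hx
  set A : Matrix (Fin n) (Fin n) ℝ := G.adjMatrix ℝ with hA
  have hH : A.IsHermitian := SimpleGraph.isHermitian_adjMatrix ℝ G
  set U : Matrix (Fin n) (Fin n) ℝ := (hH.eigenvectorUnitary : Matrix (Fin n) (Fin n) ℝ) with hU
  set Λ : Fin n → ℝ := hH.eigenvalues with hΛ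
  have hUU : Uᵀ * U = 1 := by
    have := Unitary.coe_star_mul_self hH.eigenvectorUnitary
    simpa [hU, star_eq_conjTranspose, conjTranspose_eq_transpose_of_trivial] using this
  have hUU' : U * Uᵀ = 1 := mul_eq_one_comm.1 hUU
  have hspec : A = U * diagonal Λ * Uᵀ := by
    have := hH.spectral_theorem
    simpa [hU, hΛ, Unitary.conjStarAlgAut_apply, star_eq_conjTranspose,
      conjTranspose_eq_transpose_of_trivial, Function.comp_def] using this
  set y := Uᵀ *ᵥ x with hy
  have hnorm : sqNorm x = sqNorm y := by
    rw [hy, sqNorm_mulVec, transpose_transpose, hUU', one_mulVec, sqNorm_eq_dotProduct]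
  have hquad : x ⬝ᵥ (A *ᵥ x) = ∑ i, Λ i * y i ^ 2 := by
    rw [hspec, ← mulVec_mulVec, ← mulVec_mulVec, dotProduct_mulVec, ← mulVec_transpose, ← hy,
      dotProduct]
    refine Finset.sum_congr rfl fun i _ => ?_
    rw [mulVec_diagonal]
    ring
  have hAU : A * U = U * diagonal Λ := by
    rw [hspec, Matrix.mul_assoc, hUU, Matrix.mul_one]
  have hterm : ∀ i, Λ i * y i ^ 2 ≤ 19 / 20 * d * y i ^ 2 := by
    intro i
    set v : Fin n → ℝ := fun a => U a i with hv
    have hAv : A *ᵥ v = Λ i • v := by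
      funext a
      have := congrFun (congrFun hAU a) i
      rw [mul_diagonal] at this
      rw [Pi.smul_apply, smul_eq_mul, mul_comm]
      exact this
    have hvv : sqNorm v = 1 := by
      have := congrFun (congrFun hUU i) i
      rw [mul_apply, one_apply_eq] at this
      rw [← this, sqNorm]
      exact Finset.sum_congr rfl fun a _ => by rw [transpose_apply, sq]
    have hyi : y i = v ⬝ᵥ x := rfl
    have hv0 : v ≠ 0 := by
      intro h0
      rw [h0] at hvv
      simp [sqNorm] at hvv
    have heig : Module.End.HasEigenvalue (Matrix.toLin' A) (Λ i) :=
      Module.End.hasEigenvalue_of_hasEigenvector (x := v)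
        ⟨Module.End.mem_eigenspace_iff.2 (by rw [toLin'_apply, hAv]), hv0⟩
    have hcases := hev (Λ i) (by convert heig)
    have hlt : Λ i = d → y i = 0 := by
      intro hΛd
      have h1 : sqNorm (incidence G *ᵥ v) = 0 := by
        rw [sqNorm_incidence_mulVec_of_regular hreg', ← hA, hAv, dotProduct_smul,
          ← sqNorm_eq_dotProduct, hΛd, smul_eq_mul, sub_self]
      rw [sqNorm_incidence_mulVec_eq,
        SimpleGraph.lapMatrix_toLinearMap₂'_apply'_eq_zero_iff_forall_reachable] at h1
      have hconst : ∀ a, v a = v i := fun a => h1 a i (hconn.preconnected a i)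
      rw [hyi, dotProduct]
      simp only [hconst]
      rw [← Finset.mul_sum, hx, mul_zero]
    have hle : y i = 0 ∨ Λ i ≤ 19 / 20 * d := by
      rcases hcases with hc | hc
      · rcases (abs_eq (Nat.cast_nonneg d)).1 hc with hc | hc
        · exact Or.inl (hlt hc)
        · right; linarith
      · exact Or.inr ((le_abs_self _).trans (hc.trans (two_mul_sqrt_sub_one_le hdR)))
    rcases hle with h0 | hle
    · simp [h0]
    · gcongr
  rw [sqNorm_incidence_mulVec_of_regular hreg', ← hA, hquad, hnorm]
  have hsum : ∑ i, Λ i * y i ^ 2 ≤ 19 / 20 * d * sqNorm y := by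
    rw [sqNorm, Finset.mul_sum]
    exact Finset.sum_le_sum fun i _ => hterm i
  linarith

end Ramanujan

/-! ### A Cheeger inequality -/

section Cheeger

variable {V : Type*} [Fintype V]

/-- Discrete coarea inequality: if every set of at most half the vertices has boundary weight at
least `h` times its size, then the total variation of a nonnegative function supported on at most
half the vertices is at least `h` times its sum. The induction peels off one level set of `f`. -/
lemma mul_sum_le_sum_abs_sub {w : V → V → ℝ} (hw : ∀ i j, w i j = w j i) {h : ℝ}
    [DecidableEq V]
    (hexp : ∀ S : Finset V, 2 * S.card ≤ Fintype.card V →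
      h * S.card ≤ ∑ i ∈ S, ∑ j ∈ Sᶜ, w i j)
    (f : V → ℝ) (hf : ∀ i, 0 ≤ f i)
    (hsupp : 2 * (Finset.univ.filter fun i => 0 < f i).card ≤ Fintype.card V) :
    2 * (h * ∑ i, f i) ≤ ∑ i, ∑ j, w i j * |f i - f j| := by
  obtain ⟨N, hN⟩ : ∃ N, (Finset.univ.filter fun i => 0 < f i).card = N := ⟨_, rfl⟩
  induction N using Nat.strong_induction_on generalizing f with
  | _ N ih =>
  set S := Finset.univ.filter fun i => 0 < f i with hS
  have hmem : ∀ i, i ∈ S ↔ 0 < f i := fun i => by simp [hS]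
  rcases S.eq_empty_or_nonempty with h0 | hne
  · have hz : ∀ i, f i = 0 := fun i => le_antisymm
      (not_lt.1 fun hi => by have := (hmem i).2 hi; rw [h0] at this; simp at this) (hf i)
    simp [hz]
  obtain ⟨a, haS, hmin⟩ := S.exists_min_image f hne
  set m := f a with hm
  have hm0 : 0 < m := (hmem a).1 haS
  set s : V → ℝ := fun i => if i ∈ S then 1 else 0 with hs
  set f' : V → ℝ := fun i => f i - m * s i with hf'
  have hf'0 : ∀ i, 0 ≤ f' i := by
    intro i
    by_cases hi : i ∈ S
    · simp only [hf', hs, if_pos hi, mul_one, sub_nonneg]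
      exact hmin i hi
    · simp only [hf', hs, if_neg hi, mul_zero, sub_zero]
      exact hf i
  have hsub : (Finset.univ.filter fun i => 0 < f' i) ⊆ S.erase a := by
    intro i hi
    have hi' : 0 < f' i := by simpa using hi
    have hiS : i ∈ S := by
      by_contra hc
      have : f i = 0 := le_antisymm (not_lt.1 fun hi => hc ((hmem i).2 hi)) (hf i)
      simp [hf', hs, hc, this] at hi'
    refine Finset.mem_erase.2 ⟨?_, hiS⟩
    rintro rfl
    simp [hf', hs, hiS, hm] at hi'
  have hlt : (Finset.univ.filter fun i => 0 < f' i).card < N := by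
    rw [← hN]
    exact (Finset.card_le_card hsub).trans_lt (Finset.card_erase_lt_of_mem haS)
  have h1 := ih _ hlt f' hf'0 (by omega) rfl
  have hcut : ∑ i, ∑ j, w i j * |s i - s j| = 2 * ∑ i ∈ S, ∑ j ∈ Sᶜ, w i j := by
    have hone : ∑ i ∈ S, ∑ j, w i j * |s i - s j| = ∑ i ∈ S, ∑ j ∈ Sᶜ, w i j := by
      refine Finset.sum_congr rfl fun i hi => ?_
      rw [← Finset.sum_add_sum_compl S]
      rw [Finset.sum_eq_zero fun j hj => ?_, zero_add]
      · refine Finset.sum_congr rfl fun j hj => ?_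
        simp [hs, hi, Finset.mem_compl.1 hj]
      · simp [hs, hi, hj]
    have htwo : ∑ i ∈ Sᶜ, ∑ j, w i j * |s i - s j| = ∑ i ∈ S, ∑ j ∈ Sᶜ, w i j := by
      rw [Finset.sum_comm (s := S)]
      refine Finset.sum_congr rfl fun i hi => ?_
      rw [← Finset.sum_add_sum_compl S, add_comm]
      rw [Finset.sum_eq_zero fun j hj => ?_, zero_add]
      · refine Finset.sum_congr rfl fun j hj => ?_
        simp [hs, hj, Finset.mem_compl.1 hi, hw i j]
      · simp [hs, Finset.mem_compl.1 hi, Finset.mem_compl.1 hj]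
    rw [← Finset.sum_add_sum_compl S, hone, htwo, two_mul]
  have hsplit : ∀ i j, |f i - f j| = |f' i - f' j| + m * |s i - s j| := by
    intro i j
    by_cases hi : i ∈ S <;> by_cases hj : j ∈ S
    · simp [hf', hs, hi, hj]
    · have e : f j = 0 := le_antisymm (not_lt.1 fun h => hj ((hmem j).2 h)) (hf j)
      have := hmin i hi
      simp only [hf', hs, if_pos hi, if_neg hj, e, mul_one, mul_zero, sub_zero, abs_one]
      rw [abs_of_nonneg (hf i), abs_of_nonneg (sub_nonneg.2 this)]
      ring
    · have e : f i = 0 := le_antisymm (not_lt.1 fun h => hi ((hmem i).2 h)) (hf i)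
      have := hmin j hj
      simp only [hf', hs, if_pos hj, if_neg hi, e, mul_one, mul_zero, zero_sub, sub_zero,
        abs_neg, abs_one]
      rw [abs_of_nonneg (hf j), abs_of_nonneg (sub_nonneg.2 this)]
      ring
    · simp [hf', hs, hi, hj]
  have hsum : ∑ i, f i = ∑ i, f' i + m * S.card := by
    simp only [hf', Finset.sum_sub_distrib, ← Finset.mul_sum]
    simp [hs]
  calc 2 * (h * ∑ i, f i) = 2 * (h * ∑ i, f' i) + m * (2 * (h * S.card)) := by rw [hsum]; ring
    _ ≤ ∑ i, ∑ j, w i j * |f' i - f' j| + m * (2 * ∑ i ∈ S, ∑ j ∈ Sᶜ, w i j) := by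
        have := hexp S hsupp
        gcongr
    _ = ∑ i, ∑ j, w i j * |f i - f j| := by
        rw [← hcut, Finset.mul_sum, ← Finset.sum_add_distrib]
        refine Finset.sum_congr rfl fun i _ => ?_
        rw [Finset.mul_sum, ← Finset.sum_add_distrib]
        refine Finset.sum_congr rfl fun j _ => ?_
        rw [hsplit]; ring

/-- Lower bound for the Dirichlet form of a nonnegative function supported on at most half the
vertices: apply the
coarea inequality to `f²` and the Cauchy-Schwarz inequality to
`|f i ^ 2 - f j ^ 2| = |f i - f j| (f i + f j)`. -/
lemma sq_mul_sum_sq_le_of_support {w : V → V → ℝ} (hw : ∀ i j, w i j = w j i)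
    (hw0 : ∀ i j, 0 ≤ w i j) {h D : ℝ} (hh : 0 ≤ h) (hD : ∀ i, ∑ j, w i j ≤ D)
    [DecidableEq V]
    (hexp : ∀ S : Finset V, 2 * S.card ≤ Fintype.card V →
      h * S.card ≤ ∑ i ∈ S, ∑ j ∈ Sᶜ, w i j)
    (f : V → ℝ) (hf : ∀ i, 0 ≤ f i)
    (hsupp : 2 * (Finset.univ.filter fun i => 0 < f i).card ≤ Fintype.card V) :
    h ^ 2 * ∑ i, f i ^ 2 ≤ D * ∑ i, ∑ j, w i j * (f i - f j) ^ 2 := by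
  set F := ∑ i, f i ^ 2 with hF
  set E := ∑ i, ∑ j, w i j * (f i - f j) ^ 2 with hE
  have hF0 : 0 ≤ F := Finset.sum_nonneg fun i _ => sq_nonneg _
  have hE0 : 0 ≤ E := Finset.sum_nonneg fun i _ => Finset.sum_nonneg fun j _ =>
    mul_nonneg (hw0 i j) (sq_nonneg _)
  have h1 : 2 * (h * F) ≤ ∑ i, ∑ j, w i j * |f i ^ 2 - f j ^ 2| := by
    refine mul_sum_le_sum_abs_sub hw hexp (fun i => f i ^ 2) (fun i => sq_nonneg _) ?_
    have : (Finset.univ.filter fun i => 0 < f i ^ 2) = Finset.univ.filter fun i => 0 < f i := by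
      ext i
      simp only [Finset.mem_filter, Finset.mem_univ, true_and]
      exact ⟨fun hi => lt_of_le_of_ne (hf i) fun h0 => by rw [← h0] at hi; simp at hi,
        fun hi => by positivity⟩
    rwa [this]
  have h2 : ∑ i, ∑ j, w i j * (f i + f j) ^ 2 ≤ 4 * (D * F) := by
    calc ∑ i, ∑ j, w i j * (f i + f j) ^ 2
        ≤ ∑ i, ∑ j, (2 * (w i j * f i ^ 2) + 2 * (w j i * f j ^ 2)) := by
          refine Finset.sum_le_sum fun i _ => Finset.sum_le_sum fun j _ => ?_
          rw [hw j i]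
          nlinarith [mul_nonneg (hw0 i j) (sq_nonneg (f i - f j))]
      _ = 2 * (∑ i, ∑ j, w i j * f i ^ 2) + 2 * (∑ i, ∑ j, w j i * f j ^ 2) := by
          simp only [Finset.sum_add_distrib, Finset.mul_sum]
      _ = 4 * ∑ i, (∑ j, w i j) * f i ^ 2 := by
          rw [Finset.sum_comm (f := fun i j => w j i * f j ^ 2)]
          simp only [Finset.sum_mul]
          ring
      _ ≤ 4 * (D * F) := by
          have : ∑ i, (∑ j, w i j) * f i ^ 2 ≤ D * F := by
            rw [hF, Finset.mul_sum]
            exact Finset.sum_le_sum fun i _ => mul_le_mul_of_nonneg_right (hD i) (sq_nonneg _)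
          linarith
  have h3 : (∑ i, ∑ j, w i j * |f i ^ 2 - f j ^ 2|) ^ 2 ≤
      E * ∑ i, ∑ j, w i j * (f i + f j) ^ 2 := by
    simp only [hE, ← Finset.sum_product']
    refine Finset.sum_sq_le_sum_mul_sum_of_sq_le_mul _
      (fun p _ => mul_nonneg (hw0 _ _) (sq_nonneg _))
      (fun p _ => mul_nonneg (hw0 _ _) (sq_nonneg _)) fun p _ => le_of_eq ?_
    rw [mul_pow, sq_abs]
    ring
  have h4 : (2 * (h * F)) ^ 2 ≤ E * (4 * (D * F)) :=
    (pow_le_pow_left₀ (by positivity) h1 2).trans (h3.trans (by gcongr))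
  rcases hF0.eq_or_lt with h0 | hpos
  · rw [← h0, mul_zero]
    rcases isEmpty_or_nonempty V with hV | ⟨⟨a⟩⟩
    · simp [hE]
    · exact mul_nonneg ((Finset.sum_nonneg fun j _ => hw0 a j).trans (hD a)) hE0
  · refine le_of_mul_le_mul_left ?_ (by positivity : 0 < 4 * F)
    linarith [h4]

/-- Every real function on a finite nonempty type has a median. -/
lemma exists_median [Nonempty V] (x : V → ℝ) :
    ∃ m : ℝ, 2 * (Finset.univ.filter fun i => m < x i).card ≤ Fintype.card V ∧
      2 * (Finset.univ.filter fun i => x i < m).card ≤ Fintype.card V := by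
  classical
  set T : Finset V := Finset.univ.filter fun a =>
    2 * (Finset.univ.filter fun i => x a < x i).card ≤ Fintype.card V with hT
  have hTne : T.Nonempty := by
    obtain ⟨a, -, ha⟩ := Finset.univ.exists_max_image x Finset.univ_nonempty
    refine ⟨a, ?_⟩
    have : (Finset.univ.filter fun i => x a < x i) = ∅ :=
      Finset.filter_false_of_mem fun i hi => (ha i hi).not_gt
    simp [hT, this]
  obtain ⟨a, haT, hmin⟩ := T.exists_min_image x hTne
  refine ⟨x a, (Finset.mem_filter.1 haT).2, ?_⟩
  rcases (Finset.univ.filter fun i => x i < x a).eq_empty_or_nonempty with h0 | hne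
  · simp [h0]
  -- The largest value below the median candidate has more than half of the values above it.
  obtain ⟨b, hb, hmax⟩ := (Finset.univ.filter fun i => x i < x a).exists_max_image x hne
  have hba : x b < x a := (Finset.mem_filter.1 hb).2
  have hbT : b ∉ T := fun h => (hmin b h).not_gt hba
  have hgt : Fintype.card V < 2 * (Finset.univ.filter fun i => x b < x i).card := by
    by_contra hc
    exact hbT (Finset.mem_filter.2 ⟨Finset.mem_univ _, not_lt.1 hc⟩)
  have hdisj : Disjoint (Finset.univ.filter fun i => x i < x a)
      (Finset.univ.filter fun i => x b < x i) := by
    rw [Finset.disjoint_left]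
    intro i hi hi'
    exact (hmax i hi).not_gt (Finset.mem_filter.1 hi').2
  have := Finset.card_le_univ ((Finset.univ.filter fun i => x i < x a) ∪
      (Finset.univ.filter fun i => x b < x i))
  rw [Finset.card_union_of_disjoint hdisj] at this
  omega

/-- Cheeger's inequality: edge expansion `h` and maximum degree `D` give the lower bound
`h² / (2D)` for the Dirichlet form on functions of zero mean. The positive and the negative part of
`x - m`, for a median `m` of `x`, are each supported on at most half the vertices. -/
lemma cheeger {w : V → V → ℝ} (hw : ∀ i j, w i j = w j i)
    (hw0 : ∀ i j, 0 ≤ w i j) {h D : ℝ} (hh : 0 ≤ h) (hD : ∀ i, ∑ j, w i j ≤ D)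
    [DecidableEq V]
    (hexp : ∀ S : Finset V, 2 * S.card ≤ Fintype.card V →
      h * S.card ≤ ∑ i ∈ S, ∑ j ∈ Sᶜ, w i j)
    (x : V → ℝ) (hx : ∑ i, x i = 0) :
    h ^ 2 * ∑ i, x i ^ 2 ≤ D * ∑ i, ∑ j, w i j * (x i - x j) ^ 2 := by
  rcases isEmpty_or_nonempty V with hV | hV
  · simp
  obtain ⟨m, hm1, hm2⟩ := exists_median x
  have hD0 : 0 ≤ D := by
    obtain ⟨a⟩ := hV
    exact (Finset.sum_nonneg fun j _ => hw0 a j).trans (hD a)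
  have hp := sq_mul_sum_sq_le_of_support hw hw0 hh hD hexp (fun i => max (x i - m) 0)
    (fun i => le_max_right _ _) (by simpa using hm1)
  have hq := sq_mul_sum_sq_le_of_support hw hw0 hh hD hexp (fun i => max (m - x i) 0)
    (fun i => le_max_right _ _) (by simpa using hm2)
  have hsq : ∀ t : ℝ, max t 0 ^ 2 + max (-t) 0 ^ 2 = t ^ 2 := by
    intro t
    rcases le_total t 0 with ht | ht
    · rw [max_eq_right ht, max_eq_left (by linarith)]; ring
    · rw [max_eq_left ht, max_eq_right (by linarith)]; ring
  have hdiff : ∀ s t : ℝ, (max s 0 - max t 0) ^ 2 + (max (-s) 0 - max (-t) 0) ^ 2 ≤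
      (s - t) ^ 2 := by
    intro s t
    rcases le_total s 0 with hs | hs <;> rcases le_total t 0 with ht | ht
    · rw [max_eq_right hs, max_eq_right ht, max_eq_left (by linarith : 0 ≤ -s),
        max_eq_left (by linarith : 0 ≤ -t)]; linarith
    · rw [max_eq_right hs, max_eq_left ht, max_eq_left (by linarith : 0 ≤ -s),
        max_eq_right (by linarith : -t ≤ 0)]; nlinarith
    · rw [max_eq_left hs, max_eq_right ht, max_eq_right (by linarith : -s ≤ 0),
        max_eq_left (by linarith : 0 ≤ -t)]; nlinarith
    · rw [max_eq_left hs, max_eq_left ht, max_eq_right (by linarith : -s ≤ 0),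
        max_eq_right (by linarith : -t ≤ 0)]; linarith
  have h1 : ∑ i, x i ^ 2 ≤ ∑ i, max (x i - m) 0 ^ 2 + ∑ i, max (m - x i) 0 ^ 2 := by
    have e : ∑ i, max (x i - m) 0 ^ 2 + ∑ i, max (m - x i) 0 ^ 2 =
        ∑ i, x i ^ 2 + Fintype.card V * m ^ 2 := by
      rw [← Finset.sum_add_distrib]
      have : ∀ i, max (x i - m) 0 ^ 2 + max (m - x i) 0 ^ 2 = x i ^ 2 - 2 * m * x i + m ^ 2 := by
        intro i
        have := hsq (x i - m)
        rw [neg_sub] at this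
        rw [this]; ring
      simp only [this, Finset.sum_add_distrib, Finset.sum_sub_distrib, ← Finset.mul_sum, hx]
      simp
    rw [e]
    have : (0 : ℝ) ≤ Fintype.card V * m ^ 2 := by positivity
    linarith
  have h2 : ∑ i, ∑ j, w i j * (max (x i - m) 0 - max (x j - m) 0) ^ 2 +
      ∑ i, ∑ j, w i j * (max (m - x i) 0 - max (m - x j) 0) ^ 2 ≤
      ∑ i, ∑ j, w i j * (x i - x j) ^ 2 := by
    rw [← Finset.sum_add_distrib]
    refine Finset.sum_le_sum fun i _ => ?_
    rw [← Finset.sum_add_distrib]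
    refine Finset.sum_le_sum fun j _ => ?_
    rw [← mul_add]
    refine mul_le_mul_of_nonneg_left ?_ (hw0 i j)
    have := hdiff (x i - m) (x j - m)
    rw [neg_sub, neg_sub] at this
    calc _ ≤ _ := this
      _ = _ := by ring
  calc h ^ 2 * ∑ i, x i ^ 2
      ≤ h ^ 2 * (∑ i, max (x i - m) 0 ^ 2 + ∑ i, max (m - x i) 0 ^ 2) := by gcongr
    _ ≤ D * (∑ i, ∑ j, w i j * (max (x i - m) 0 - max (x j - m) 0) ^ 2 +
      ∑ i, ∑ j, w i j * (max (m - x i) 0 - max (m - x j) 0) ^ 2) := by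
        rw [mul_add, mul_add]; exact add_le_add hp hq
    _ ≤ _ := by gcongr

end Cheeger

/-- Cheeger's inequality for a graph on `Fin n`, in terms of its Laplacian spectral gap. -/
lemma hasGap_of_expansion {n : ℕ} {G : SimpleGraph (Fin n)} [DecidableRel G.Adj] {h D : ℝ}
    (hh : 0 ≤ h) (hD0 : 0 < D) (hD : ∀ i, (∑ j, if G.Adj i j then (1 : ℝ) else 0) ≤ D)
    (hexp : ∀ S : Finset (Fin n), 2 * S.card ≤ n →
      h * S.card ≤ ∑ i ∈ S, ∑ j ∈ Sᶜ, if G.Adj i j then (1 : ℝ) else 0) :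
    HasGap G (h ^ 2 / (2 * D)) := by
  intro x hx
  have h1 := cheeger (w := fun i j => if G.Adj i j then (1 : ℝ) else 0)
    (fun i j => by simp only [G.adj_comm]) (fun i j => by split_ifs <;> norm_num) hh hD
    (by simpa using hexp) x hx
  have h2 := two_mul_sqNorm_incidence_mulVec (G := G) x
  have h3 : ∑ i, ∑ j, (if G.Adj i j then (1 : ℝ) else 0) * (x i - x j) ^ 2 =
      2 * sqNorm (incidence G *ᵥ x) := by
    rw [h2]
    simp only [ite_mul, one_mul, zero_mul]
  rw [h3] at h1
  rw [div_mul_eq_mul_div, div_le_iff₀ (by positivity)]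
  calc h ^ 2 * sqNorm x ≤ D * (2 * sqNorm (incidence G *ᵥ x)) := h1
    _ = _ := by ring

/-! ### Erdős–Rényi random graphs -/

section ErdosRenyi

variable {n : ℕ}

instance : MeasurableSingletonClass (SimpleGraph (Fin n)) where
  measurableSet_singleton G := by
    have : ({G} : Set (SimpleGraph (Fin n))) = SimpleGraph.edgeSet ⁻¹' {G.edgeSet} := by
      ext H; simp
    rw [this]
    exact SimpleGraph.measurable_edgeSet (measurableSet_singleton _)

open Classical in
/-- The number of edges of `G` between `S` and its complement. -/
noncomputable def cutSize (G : SimpleGraph (Fin n)) (S : Finset (Fin n)) : ℝ :=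
  ∑ i ∈ S, ∑ j ∈ Sᶜ, if G.Adj i j then 1 else 0

/-- The pairs of vertices separated by `S`. -/
def cutPairs (S : Finset (Fin n)) : Finset (Sym2 (Fin n)) :=
  (S ×ˢ Sᶜ).image fun q => s(q.1, q.2)

lemma injOn_cutPairs (S : Finset (Fin n)) :
    Set.InjOn (fun q : Fin n × Fin n => s(q.1, q.2)) (S ×ˢ Sᶜ : Finset (Fin n × Fin n)) := by
  rintro ⟨a, b⟩ hab ⟨a', b'⟩ hab' h
  simp only [Finset.coe_product, Set.mem_prod, Finset.mem_coe, Finset.mem_compl] at hab hab'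
  rcases Sym2.eq_iff.1 h with ⟨rfl, rfl⟩ | ⟨rfl, rfl⟩
  · rfl
  · exact absurd hab.1 hab'.2

lemma card_cutPairs (S : Finset (Fin n)) : (cutPairs S).card = S.card * (n - S.card) := by
  rw [cutPairs, Finset.card_image_of_injOn (injOn_cutPairs S), Finset.card_product,
    Finset.card_compl, Fintype.card_fin]

lemma not_isDiag_of_mem_cutPairs {S : Finset (Fin n)} {e : Sym2 (Fin n)} (he : e ∈ cutPairs S) :
    ¬ e.IsDiag := by
  obtain ⟨⟨a, b⟩, hab, rfl⟩ := Finset.mem_image.1 he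
  simp only [Finset.mem_product, Finset.mem_compl] at hab
  rw [Sym2.mk_isDiag_iff]
  intro h
  have h' : a = b := h
  exact hab.2 (h' ▸ hab.1)

open Classical in
lemma cutSize_eq_sum (G : SimpleGraph (Fin n)) (S : Finset (Fin n)) :
    cutSize G S = ∑ e ∈ cutPairs S, if e ∈ G.edgeSet then 1 else 0 := by
  rw [cutPairs, Finset.sum_image (injOn_cutPairs S), cutSize, Finset.sum_product]
  rfl

/-- The moment generating function of the binomial number of edges across a cut. -/
lemma integral_exp_cutSize (p : unitInterval) (S : Finset (Fin n)) (u : ℝ) :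
    ∫ G, Real.exp (u * cutSize G S) ∂(SimpleGraph.binomialRandom (Fin n) p) =
      (p * Real.exp u + (1 - p)) ^ (cutPairs S).card := by
  classical
  set f : Sym2 (Fin n) → Prop → ℝ :=
    fun e q => if e ∈ cutPairs S ∧ q then Real.exp u else 1 with hf
  rw [SimpleGraph.binomialRandom_eq_map, setBernoulli_eq_map, Measure.infinitePi_eq_pi,
    integral_map (by fun_prop) (measurable_of_finite _).aestronglyMeasurable,
    integral_map (by fun_prop) (measurable_of_finite _).aestronglyMeasurable]
  have hint : ∀ q : Sym2 (Fin n) → Prop,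
      Real.exp (u * cutSize (SimpleGraph.fromEdgeSet {e | q e}) S) = ∏ e, f e (q e) := by
    intro q
    rw [cutSize_eq_sum, Finset.mul_sum, Real.exp_sum, ← Finset.prod_subset
      (Finset.subset_univ (cutPairs S)) fun e _ he => by simp [hf, he]]
    refine Finset.prod_congr rfl fun e he => ?_
    have hd := not_isDiag_of_mem_cutPairs he
    by_cases hq : q e <;> simp [hf, he, hq, hd]
  simp only [hint]
  rw [integral_fintype_prod_eq_prod]
  have hone : ∀ e, ∫ q, f e q ∂(unitInterval.toNNReal p •
      Measure.dirac (e ∈ (Sym2.diagSetᶜ : Set (Sym2 (Fin n)))) +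
        unitInterval.toNNReal (unitInterval.symm p) • Measure.dirac False) =
      if e ∈ cutPairs S then p * Real.exp u + (1 - p) else 1 := by
    intro e
    rw [integral_add_measure Integrable.of_finite Integrable.of_finite,
      integral_smul_nnreal_measure, integral_smul_nnreal_measure, integral_dirac, integral_dirac]
    by_cases he : e ∈ cutPairs S
    · have hd := not_isDiag_of_mem_cutPairs he
      simp [hf, he, hd, NNReal.smul_def]
    · simp [hf, he, NNReal.smul_def]
  simp only [hone]
  rw [Finset.prod_ite_mem, Finset.univ_inter, Finset.prod_const]

/-- Chernoff bound for the number of edges across a cut. The case `u < 0` bounds the lower tail. -/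
lemma binomialRandom_real_cutSize_le (p : unitInterval) (S : Finset (Fin n)) (u s : ℝ) :
    (SimpleGraph.binomialRandom (Fin n) p).real {G | s ≤ u * cutSize G S} ≤
      Real.exp (-s + S.card * (n - S.card) * p * (Real.exp u - 1)) := by
  have h := mul_meas_ge_le_integral_of_nonneg (μ := SimpleGraph.binomialRandom (Fin n) p)
    (f := fun G => Real.exp (u * cutSize G S)) (ae_of_all _ fun G => (Real.exp_pos _).le)
    Integrable.of_finite (Real.exp s)
  rw [integral_exp_cutSize] at h
  simp only [Real.exp_le_exp] at h
  have hp0 : (0 : ℝ) ≤ p := p.2.1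
  have hp1 : (p : ℝ) ≤ 1 := p.2.2
  have h1 : (p * Real.exp u + (1 - p)) ^ (cutPairs S).card ≤
      Real.exp (S.card * (n - S.card) * p * (Real.exp u - 1)) := by
    have hc : ((cutPairs S).card : ℝ) = S.card * (n - S.card) := by
      rw [card_cutPairs, Nat.cast_mul, Nat.cast_sub]
      simpa using S.card_le_univ
    calc (p * Real.exp u + (1 - p)) ^ (cutPairs S).card
        ≤ Real.exp (p * (Real.exp u - 1)) ^ (cutPairs S).card := by
          refine pow_le_pow_left₀ (by have := Real.exp_pos u; nlinarith) ?_ _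
          have := Real.add_one_le_exp (p * (Real.exp u - 1))
          linarith
      _ = _ := by rw [← Real.exp_nat_mul, hc]; ring_nf
  rw [Real.exp_add, Real.exp_neg, inv_mul_eq_div, le_div_iff₀ (Real.exp_pos s), mul_comm]
  exact h.trans h1

/-- The probability that some vertex has degree above `4np`. -/
lemma binomialRandom_real_degree_le {p : unitInterval} (hn : 0 < n)
    (hd : Real.log n ≤ n * (p : ℝ)) :
    (SimpleGraph.binomialRandom (Fin n) p).real {G | ∃ i, 4 * (n * (p : ℝ)) ≤ cutSize G {i}} ≤
      Real.exp (-Real.log n) := by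
  have hn' : (0 : ℝ) < n := by exact_mod_cast hn
  have hp0 : (0 : ℝ) ≤ p := p.2.1
  have hone : ∀ i : Fin n, (SimpleGraph.binomialRandom (Fin n) p).real
      {G | 4 * (n * (p : ℝ)) ≤ cutSize G {i}} ≤ Real.exp (-2 * Real.log n) := by
    intro i
    have h := binomialRandom_real_cutSize_le p {i} 1 (4 * (n * (p : ℝ)))
    simp only [one_mul, Finset.card_singleton, Nat.cast_one] at h
    refine h.trans (Real.exp_le_exp.2 ?_)
    have he : Real.exp 1 - 1 ≤ 2 := by linarith [Real.exp_one_lt_d9]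
    have he0 : 0 ≤ Real.exp 1 - 1 := by linarith [Real.add_one_le_exp (1 : ℝ)]
    have h1 : ((n : ℝ) - 1) * p * (Real.exp 1 - 1) ≤ n * p * 2 := by
      have : ((n : ℝ) - 1) * p ≤ n * p := by nlinarith
      calc ((n : ℝ) - 1) * p * (Real.exp 1 - 1) ≤ n * p * (Real.exp 1 - 1) := by gcongr
        _ ≤ _ := by gcongr
    linarith
  have hset : {G : SimpleGraph (Fin n) | ∃ i, 4 * (n * (p : ℝ)) ≤ cutSize G {i}} =
      ⋃ i, {G | 4 * (n * (p : ℝ)) ≤ cutSize G {i}} := by ext; simp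
  rw [hset]
  calc _ ≤ ∑ i : Fin n, (SimpleGraph.binomialRandom (Fin n) p).real
        {G | 4 * (n * (p : ℝ)) ≤ cutSize G {i}} := measureReal_iUnion_fintype_le _
    _ ≤ ∑ _i : Fin n, Real.exp (-2 * Real.log n) := Finset.sum_le_sum fun i _ => hone i
    _ = n * Real.exp (-2 * Real.log n) := by simp
    _ = Real.exp (Real.log n) * Real.exp (-2 * Real.log n) := by rw [Real.exp_log hn']
    _ = _ := by rw [← Real.exp_add]; ring_nf

/-- Failure of expansion for a fixed set `S` of at most half the vertices. Small sets are beaten by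
the factor `n^{-(1+δ/2)|S|}`, which suffices against the at most `n^{|S|}` sets of this size, and
large sets by a factor that is superexponentially small in `n`. -/
lemma binomialRandom_real_cutSize_lt_le {p : unitInterval} {δ η : ℝ} (hδ : 0 < δ)
    (hη : η = δ / (6 * (1 + δ))) (hn : 0 < n) (hd : (1 + δ) * Real.log n ≤ n * (p : ℝ))
    (S : Finset (Fin n)) (hS : 2 * S.card ≤ n) :
    (SimpleGraph.binomialRandom (Fin n) p).real
        {G | cutSize G S < η / (-Real.log η) * (n * (p : ℝ)) * S.card} ≤
      Real.exp (-((1 + δ / 2) * Real.log n)) ^ S.card +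
        Real.exp (-(η / 4 * Real.log n)) ^ n := by
  have hη0 : 0 < η := by rw [hη]; positivity
  have hη1 : η ≤ 1 / 6 := by
    rw [hη, div_le_iff₀ (by positivity)]
    linarith
  -- The choice of `η`: small sets lose the factor `1 - 3 η` and must stay above the threshold.
  have hηδ : (1 + δ) * (1 - 3 * η) = 1 + δ / 2 := by
    rw [hη]
    field_simp
    ring
  have hn' : (0 : ℝ) < n := by exact_mod_cast hn
  have hlog : 0 ≤ Real.log n := Real.log_natCast_nonneg n
  -- Chernoff parameter `-u` with `exp (-u) = η`; then `u * (η / u) = η` is the loss in the exponent.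
  set u := -Real.log η with hu
  have hu0 : 0 < u := neg_pos.2 (Real.log_neg hη0 (by linarith))
  have hexpu : Real.exp (-u) = η := by rw [hu, neg_neg, Real.exp_log hη0]
  obtain ⟨d, hdd⟩ : ∃ d : ℝ, d = n * (p : ℝ) := ⟨_, rfl⟩
  rw [← hdd] at hd ⊢
  obtain ⟨s, hs⟩ : ∃ s : ℝ, s = S.card := ⟨_, rfl⟩
  rw [← hs]
  have hs0 : 0 ≤ s := hs ▸ Nat.cast_nonneg _
  have hS' : 2 * s ≤ n := by rw [hs]; exact_mod_cast hS
  have hd0 : 0 ≤ d := le_trans (by positivity) hd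
  have hd1 : Real.log n ≤ d := by nlinarith
  have hp : (p : ℝ) = d / n := by rw [hdd]; field_simp
  have h1 : (SimpleGraph.binomialRandom (Fin n) p).real
        {G | cutSize G S < η / u * d * s} ≤
      Real.exp (-(s * d * ((1 - s / n) * (1 - η) - η))) := by
    have h := binomialRandom_real_cutSize_le p S (-u) (-(η * d * s))
    refine (measureReal_mono fun G hG => ?_).trans (h.trans_eq ?_)
    · simp only [Set.mem_ofPred_eq] at hG ⊢
      have : u * cutSize G S ≤ u * (η / u * d * s) := by gcongr
      have e : u * (η / u * d * s) = η * d * s := by field_simp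
      linarith
    · rw [hexpu, ← hs, hp]
      congr 1
      field_simp
      ring
  refine h1.trans ?_
  by_cases hsmall : s ≤ η * n
  · refine le_trans ?_ (le_add_of_nonneg_right (by positivity))
    rw [← Real.exp_nat_mul, ← hs, Real.exp_le_exp, mul_neg, neg_le_neg_iff]
    have hb : 1 - 3 * η ≤ (1 - s / n) * (1 - η) - η := by
      have : s / n ≤ η := (div_le_iff₀ hn').2 hsmall
      nlinarith
    calc s * ((1 + δ / 2) * Real.log n) = s * ((1 + δ) * Real.log n) * (1 - 3 * η) := by
          rw [← hηδ]; ring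
      _ ≤ s * d * (1 - 3 * η) := by
          have : 0 ≤ 1 - 3 * η := by linarith
          gcongr
      _ ≤ _ := by gcongr
  · refine le_trans ?_ (le_add_of_nonneg_left (by positivity))
    rw [← Real.exp_nat_mul, Real.exp_le_exp, mul_neg, neg_le_neg_iff]
    have hb : 1 / 4 ≤ (1 - s / n) * (1 - η) - η := by
      have : s / n ≤ 1 / 2 := by rw [div_le_iff₀ hn']; linarith
      nlinarith
    calc n * (η / 4 * Real.log n) = (η * n) * Real.log n * (1 / 4) := by ring
      _ ≤ s * d * (1 / 4) := by
          have := (not_le.1 hsmall).le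
          gcongr
      _ ≤ _ := by gcongr

/-- A graph with large cuts and small degrees has a spectral gap, by Cheeger's inequality. -/
lemma hasGap_of_cutSize {G : SimpleGraph (Fin n)} {c d : ℝ} (hc : 0 ≤ c) (hd : 0 < d)
    (hdeg : ∀ i, cutSize G {i} ≤ 4 * d)
    (hcut : ∀ S : Finset (Fin n), S.Nonempty → 2 * S.card ≤ n → c * d * S.card ≤ cutSize G S) :
    HasGap G (c ^ 2 / 8 * d) := by
  classical
  have e : c ^ 2 / 8 * d = (c * d) ^ 2 / (2 * (4 * d)) := by field_simp; ring
  rw [e]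
  refine hasGap_of_expansion (by positivity) (by positivity) (fun i => ?_) fun S hS => ?_
  · refine le_trans (le_of_eq ?_) (hdeg i)
    rw [cutSize, Finset.sum_singleton, ← Finset.sum_add_sum_compl {i}, Finset.sum_singleton,
      if_neg (G.irrefl), zero_add]
  · rcases S.eq_empty_or_nonempty with rfl | hne
    · simp
    · refine (hcut S hne hS).trans (le_of_eq ?_)
      rw [cutSize]

/-- Above the connectivity threshold, `np ≥ (1 + δ) log n`, the Erdős–Rényi graph has a spectral
gap of order `np` with high probability. -/
theorem binomialRandom_hasGap {δ : ℝ} (hδ : 0 < δ) :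
    ∃ c : ℝ, 0 < c ∧ ∃ e : ℕ → ℝ, Tendsto e atTop (nhds 0) ∧
      ∀ (n : ℕ) (p : unitInterval), 2 ≤ n → (1 + δ) * Real.log n ≤ n * (p : ℝ) →
        (SimpleGraph.binomialRandom (Fin n) p).real
          {G | ¬ HasGap G (c * (n * (p : ℝ)))} ≤ e n := by
  obtain ⟨η, hη⟩ : ∃ η, η = δ / (6 * (1 + δ)) := ⟨_, rfl⟩
  have hη0 : 0 < η := by rw [hη]; positivity
  have hη1 : η < 1 := by
    rw [hη, div_lt_iff₀ (by positivity)]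
    linarith
  set c₀ := η / (-Real.log η) with hc₀
  have hc₀0 : 0 < c₀ := div_pos hη0 (neg_pos.2 (Real.log_neg hη0 hη1))
  have hlogtop : Tendsto (fun n : ℕ => Real.log n) atTop atTop :=
    Real.tendsto_log_atTop.comp tendsto_natCast_atTop_atTop
  have hdecay : ∀ a : ℝ, 0 < a →
      Tendsto (fun n : ℕ => Real.exp (-(a * Real.log n))) atTop (nhds 0) := fun a ha =>
    Real.tendsto_exp_atBot.comp (tendsto_neg_atTop_atBot.comp (hlogtop.const_mul_atTop ha))
  refine ⟨c₀ ^ 2 / 8, by positivity, fun n => (Real.exp (Real.exp (-(δ / 2 * Real.log n))) - 1) +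
    (2 * Real.exp (-(η / 4 * Real.log n))) ^ n + Real.exp (-Real.log n), ?_, ?_⟩
  · have h1 : Tendsto (fun n : ℕ => Real.exp (Real.exp (-(δ / 2 * Real.log n))) - 1) atTop
        (nhds (Real.exp 0 - 1)) :=
      ((Real.continuous_exp.tendsto 0).comp (hdecay _ (half_pos hδ))).sub_const 1
    have h2 : Tendsto (fun n : ℕ => (2 * Real.exp (-(η / 4 * Real.log n))) ^ n) atTop
        (nhds 0) := by
      refine squeeze_zero' (Eventually.of_forall fun n => by positivity) ?_
        (tendsto_pow_atTop_nhds_zero_of_lt_one (r := (1 / 2 : ℝ)) (by norm_num) (by norm_num))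
      filter_upwards [(hdecay (η / 4) (by positivity)).eventually_lt_const
        (by norm_num : (0 : ℝ) < 1 / 4)] with n hn
      exact pow_le_pow_left₀ (by positivity) (by linarith) n
    have h3 := hdecay 1 one_pos
    simp only [one_mul] at h3
    simpa using (h1.add h2).add h3
  · intro n p hn hd
    have hn' : (0 : ℝ) < n := by exact_mod_cast (by omega : 0 < n)
    have hlog : 0 < Real.log n := Real.log_pos (by exact_mod_cast hn)
    have hd0 : 0 < n * (p : ℝ) := lt_of_lt_of_le (by positivity) hd
    set P := SimpleGraph.binomialRandom (Fin n) p with hP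
    set x := Real.exp (-((1 + δ / 2) * Real.log n)) with hx
    set y := Real.exp (-(η / 4 * Real.log n)) with hy
    set bad : Finset (Fin n) → Set (SimpleGraph (Fin n)) := fun S =>
      {G | S.Nonempty ∧ 2 * S.card ≤ n ∧ cutSize G S < c₀ * (n * (p : ℝ)) * S.card} with hbad
    have hsub : {G | ¬ HasGap G (c₀ ^ 2 / 8 * (n * (p : ℝ)))} ⊆
        (⋃ S, bad S) ∪ {G | ∃ i, 4 * (n * (p : ℝ)) ≤ cutSize G {i}} := by
      intro G hG
      by_contra hcon
      simp only [Set.mem_union, Set.mem_iUnion, hbad, Set.mem_ofPred_eq, not_or, not_exists,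
        not_and, not_lt, not_le] at hcon
      exact hG (hasGap_of_cutSize hc₀0.le hd0 (fun i => (hcon.2 i).le) hcon.1)
    have hbadS : ∀ S, P.real (bad S) ≤ if S = ∅ then 0 else x ^ S.card + y ^ n := by
      intro S
      split_ifs with h0
      · have : bad S = ∅ := by
          ext G; simp [hbad, h0]
        rw [this, measureReal_empty]
      · by_cases hS : 2 * S.card ≤ n
        · exact (measureReal_mono fun G hG => hG.2.2).trans
            (binomialRandom_real_cutSize_lt_le hδ hη (by omega) hd S hS)
        · have : bad S = ∅ := by
            ext G; simp [hbad, hS]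
          rw [this, measureReal_empty]
          positivity
    have hsumx : ∑ S : Finset (Fin n), x ^ S.card = (1 + x) ^ n := by
      have := Finset.sum_pow_mul_eq_add_pow x 1 (Finset.univ : Finset (Fin n))
      simpa [add_comm] using this
    have hunion : P.real (⋃ S, bad S) ≤ (Real.exp (Real.exp (-(δ / 2 * Real.log n))) - 1) +
        (2 * y) ^ n := by
      calc P.real (⋃ S, bad S) ≤ ∑ S, P.real (bad S) := measureReal_iUnion_fintype_le _
        _ ≤ ∑ S : Finset (Fin n), ((x ^ S.card - if S = ∅ then 1 else 0) + y ^ n) := by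
            refine Finset.sum_le_sum fun S _ => (hbadS S).trans ?_
            split_ifs with h0
            · have : 0 ≤ y ^ n := by positivity
              simpa [h0] using this
            · simp
        _ = ((1 + x) ^ n - 1) + (2 * y) ^ n := by
            rw [Finset.sum_add_distrib, Finset.sum_sub_distrib, hsumx]
            simp [mul_pow]
        _ ≤ _ := by
            have h1 : (1 + x) ^ n ≤ Real.exp x ^ n :=
              pow_le_pow_left₀ (by positivity) (by linarith [Real.add_one_le_exp x]) n
            have h2 : Real.exp x ^ n = Real.exp (Real.exp (-(δ / 2 * Real.log n))) := by
              rw [← Real.exp_nat_mul]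
              congr 1
              calc n * x = Real.exp (Real.log n) * x := by rw [Real.exp_log hn']
                _ = _ := by rw [hx, ← Real.exp_add]; ring_nf
            linarith
    have hdeg := binomialRandom_real_degree_le (p := p) (by omega : 0 < n)
      (by nlinarith : Real.log n ≤ n * (p : ℝ))
    exact (measureReal_mono hsub).trans ((measureReal_union_le _ _).trans (add_le_add hunion hdeg))

end ErdosRenyi

/-! ### The three error bounds -/

/-- Conditioning on a random element with finitely many values: the section bound needs to hold only
off an exceptional set. The set `S` need not be measurable. -/
lemma prod_measure_le_add {α β : Type*} [MeasurableSpace α] [MeasurableSpace β] [Finite α]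
    [MeasurableSingletonClass α] (μ : Measure α) [IsProbabilityMeasure μ] (ν : Measure β)
    [IsProbabilityMeasure ν] (S : Set (α × β)) (B : Set α) {η : ENNReal}
    (h : ∀ a, a ∉ B → ν {b | (a, b) ∈ S} ≤ η) : μ.prod ν S ≤ μ B + η := by
  have := Fintype.ofFinite α
  have hsub : S ⊆ B ×ˢ Set.univ ∪ ⋃ a, {a} ×ˢ {b | a ∉ B ∧ (a, b) ∈ S} := by
    rintro ⟨a, b⟩ hab
    by_cases ha : a ∈ B
    · exact Or.inl ⟨ha, Set.mem_univ _⟩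
    · exact Or.inr (Set.mem_iUnion.2 ⟨a, rfl, ha, hab⟩)
  have hsec : ∀ a, ν {b | a ∉ B ∧ (a, b) ∈ S} ≤ η := by
    intro a
    by_cases ha : a ∈ B
    · simp [ha]
    · exact (measure_mono fun b hb => hb.2).trans (h a ha)
  calc μ.prod ν S ≤ μ.prod ν (B ×ˢ Set.univ) +
        μ.prod ν (⋃ a, {a} ×ˢ {b | a ∉ B ∧ (a, b) ∈ S}) :=
        (measure_mono hsub).trans (measure_union_le _ _)
    _ ≤ μ B + ∑ a, μ {a} * η := by
        gcongr
        · rw [Measure.prod_prod, measure_univ, mul_one]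
        · refine (measure_iUnion_fintype_le _ _).trans (Finset.sum_le_sum fun a _ => ?_)
          rw [Measure.prod_prod]
          gcongr
          exact hsec a
    _ = μ B + η := by
        rw [← Finset.sum_mul, sum_measure_singleton, Finset.coe_univ, measure_univ, one_mul]

theorem isBigOP_univDiff (k : ℕ) {σ : ℝ≥0} (hσ : 0 < σ) {c₁ c₂ : ℝ} (hc₁ : √2 * (σ : ℝ) < c₁)
    (lam : ℕ → ℝ) (β₀ : ∀ n, Fin n → ℝ) (βhat : ∀ n, (Fin n → ℝ) → (Fin n → ℝ))
    (hlam : ∀ n, c₁ * tuningScale (univDiff n (k + 1)) ≤ lam n ∧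
      lam n ≤ c₂ * tuningScale (univDiff n (k + 1)))
    (hβ : ∀ n y, IsGenLasso (univDiff n (k + 1)) (lam n) y (βhat n y)) :
    IsBigOP (fun n => noise σ n)
      (fun n ε => sqNorm (βhat n (β₀ n + ε) - β₀ n) / n)
      (fun n _ => 1 / (n : ℝ) + √(Real.log n / n) * ((n : ℝ) ^ k *
        l1 (univDiff n (k + 1) *ᵥ β₀ n))) := by
  intro η hη
  obtain ⟨C, N, h⟩ := genLasso_error_uniform σ hσ (c₂ := c₂) hc₁ (k + 1) (K := 1) hη
  refine ⟨C, ?_⟩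
  filter_upwards [eventually_ge_atTop N, eventually_gt_atTop (k + 1)] with n hn hk
  have := h n hn _ (univDiff n (k + 1)) (lam n) (√(Real.log n / n) * (n : ℝ) ^ k) (β₀ n) (βhat n)
    (trace_kerProj_univDiff hk.le).le (by positivity) (tuningScale_univDiff_le hk)
    (hlam n).1 (hlam n).2 (hβ n)
  simpa only [mul_assoc] using this

/-- The error bound for graph trend filtering, uniformly over all graphs on sufficiently many
vertices with spectral gap at least `c d`. -/
theorem genLasso_error_of_hasGap (k : ℕ) {σ : ℝ≥0} (hσ : 0 < σ) {c₁ c₂ : ℝ}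
    (hc₁ : √2 * (σ : ℝ) < c₁) {c η : ℝ} (hc : 0 < c) (hη : 0 < η) :
    ∃ C : ℝ, ∃ N : ℕ, ∀ (n : ℕ), N ≤ n → ∀ (G : SimpleGraph (Fin n)) (d lam : ℝ)
      (β₀ : Fin n → ℝ) (b : (Fin n → ℝ) → Fin n → ℝ), 1 ≤ d → HasGap G (c * d) →
      c₁ * tuningScale (graphDiff G k) ≤ lam → lam ≤ c₂ * tuningScale (graphDiff G k) →
      (∀ y, IsGenLasso (graphDiff G k) lam y (b y)) →
      noise σ n {ε | C * |1 / (n : ℝ) + √(Real.log (n * d)) / (n * d ^ (((k : ℝ) + 1) / 2)) *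
        l1 (graphDiff G k *ᵥ β₀)| < |sqNorm (b (β₀ + ε) - β₀) / n|} ≤ ENNReal.ofReal η := by
  obtain ⟨C, N, h⟩ := genLasso_error_uniform σ hσ (c₂ := c₂) hc₁ 1
    (K := (√(c ^ (k + 1)))⁻¹ * √2) hη
  refine ⟨C, N + 1, fun n hn G d lam β₀ b hd hgap hl1 hl2 hb => ?_⟩
  have hg : 0 < c * d := by positivity
  have htr := hgap.trace_kerProj hg k (by omega)
  exact h n (by omega) _ (graphDiff G k) lam _ β₀ b (by simp [htr])
    (by positivity) (hgap.tuningScale_graphDiff_le hc hd k (by omega)) hl1 hl2 hb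

theorem isBigOP_erdosRenyi (k : ℕ) {σ : ℝ≥0} (hσ : 0 < σ) {c₁ c₂ : ℝ}
    (hc₁ : √2 * (σ : ℝ) < c₁) (p : ℕ → unitInterval) {δ : ℝ} (hδ : 0 < δ)
    (hp : ∀ᶠ n : ℕ in atTop, (1 + δ) * Real.log n ≤ n * (p n : ℝ))
    (lam : ∀ n, SimpleGraph (Fin n) → ℝ) (β₀ : ∀ n, SimpleGraph (Fin n) → (Fin n → ℝ))
    (βhat : ∀ n, SimpleGraph (Fin n) → (Fin n → ℝ) → (Fin n → ℝ))
    (hlam : ∀ n G, c₁ * tuningScale (graphDiff G k) ≤ lam n G ∧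
      lam n G ≤ c₂ * tuningScale (graphDiff G k))
    (hβ : ∀ n G y, IsGenLasso (graphDiff G k) (lam n G) y (βhat n G y)) :
    IsBigOP (fun n => (SimpleGraph.binomialRandom (Fin n) (p n)).prod (noise σ n))
      (fun n ω => sqNorm (βhat n ω.1 (β₀ n ω.1 + ω.2) - β₀ n ω.1) / n)
      (fun n ω => 1 / (n : ℝ) +
        √(Real.log (n * (n * (p n : ℝ)))) / (n * (n * (p n : ℝ)) ^ (((k : ℝ) + 1) / 2)) *
          l1 (graphDiff ω.1 k *ᵥ β₀ n ω.1)) := by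
  intro η hη
  obtain ⟨c, hc, e, he, hgap⟩ := binomialRandom_hasGap hδ
  obtain ⟨C, N, h⟩ := genLasso_error_of_hasGap k hσ (c₂ := c₂) hc₁ hc (half_pos hη)
  refine ⟨C, ?_⟩
  have hlog : Tendsto (fun n : ℕ => Real.log n) atTop atTop :=
    Real.tendsto_log_atTop.comp tendsto_natCast_atTop_atTop
  filter_upwards [eventually_ge_atTop N, eventually_ge_atTop 2, hp,
    hlog.eventually_ge_atTop 1, he.eventually_lt_const (half_pos hη)] with n hn h2 hpn hl hen
  have hd : 1 ≤ n * (p n : ℝ) := by nlinarith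
  refine (prod_measure_le_add _ _ _ {G | ¬ HasGap G (c * (n * (p n : ℝ)))}
    (η := ENNReal.ofReal (η / 2)) fun G hG => ?_).trans ?_
  · exact h n hn G _ (lam n G) (β₀ n G) (βhat n G) hd (not_not.1 hG) (hlam n G).1 (hlam n G).2
      (hβ n G)
  · rw [← ofReal_measureReal, ← ENNReal.ofReal_add measureReal_nonneg (half_pos hη).le]
    refine ENNReal.ofReal_le_ofReal ?_
    linarith [hgap n (p n) h2 hpn]

theorem isBigOP_ramanujan (k : ℕ) {σ : ℝ≥0} (hσ : 0 < σ) {c₁ c₂ : ℝ}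
    (hc₁ : √2 * (σ : ℝ) < c₁) (n d : ℕ → ℕ) (G : ∀ m, SimpleGraph (Fin (n m)))
    (hn : Tendsto n atTop atTop) (hd : ∀ m, 3 ≤ d m) (hG : ∀ m, IsRamanujan (G m) (d m))
    (lam : ℕ → ℝ) (β₀ : ∀ m, Fin (n m) → ℝ) (βhat : ∀ m, (Fin (n m) → ℝ) → (Fin (n m) → ℝ))
    (hlam : ∀ m, c₁ * tuningScale (graphDiff (G m) k) ≤ lam m ∧
      lam m ≤ c₂ * tuningScale (graphDiff (G m) k))
    (hβ : ∀ m y, IsGenLasso (graphDiff (G m) k) (lam m) y (βhat m y)) :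
    IsBigOP (fun m => noise σ (n m))
      (fun m ε => sqNorm (βhat m (β₀ m + ε) - β₀ m) / n m)
      (fun m _ => 1 / (n m : ℝ) +
        √(Real.log ((n m : ℝ) * d m)) / ((n m : ℝ) * (d m : ℝ) ^ (((k : ℝ) + 1) / 2)) *
          l1 (graphDiff (G m) k *ᵥ β₀ m)) := by
  intro η hη
  obtain ⟨C, N, h⟩ := genLasso_error_of_hasGap k hσ (c₂ := c₂) hc₁
    (by norm_num : (0 : ℝ) < 1 / 20) hη
  refine ⟨C, ?_⟩
  filter_upwards [hn.eventually_ge_atTop N] with m hm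
  have h3 : (3 : ℝ) ≤ d m := by exact_mod_cast hd m
  exact h (n m) hm (G m) (d m) (lam m) (β₀ m) (βhat m) (by linarith) ((hG m).hasGap (hd m))
    (hlam m).1 (hlam m).2 (hβ m)

end GTF

theorem corollary1 (k : ℕ) (σ : ℝ≥0) (hσ : 0 < σ) (c₁ c₂ : ℝ) (hc₁ : √2 * (σ : ℝ) < c₁) :
    -- univariate trend filtering
    (∀ (lam : ℕ → ℝ) (β₀ : ∀ n, Fin n → ℝ) (βhat : ∀ n, (Fin n → ℝ) → (Fin n → ℝ)),
      (∀ n, c₁ * GTF.tuningScale (GTF.univDiff n (k + 1)) ≤ lam n ∧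
        lam n ≤ c₂ * GTF.tuningScale (GTF.univDiff n (k + 1))) →
      (∀ n y, GTF.IsGenLasso (GTF.univDiff n (k + 1)) (lam n) y (βhat n y)) →
      GTF.IsBigOP (fun n => GTF.noise σ n)
        (fun n ε => GTF.sqNorm (βhat n (β₀ n + ε) - β₀ n) / n)
        (fun n _ => 1 / (n : ℝ) + √(Real.log n / n) * ((n : ℝ) ^ k *
          GTF.l1 (GTF.univDiff n (k + 1) *ᵥ β₀ n)))) ∧
    -- Erdős–Rényi random graphs, independent of the noise, with `d = n p`
    (∀ (p : ℕ → unitInterval) (δ : ℝ), 0 < δ →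
      (∀ᶠ n : ℕ in atTop, (1 + δ) * Real.log n ≤ n * (p n : ℝ)) →
      ∀ (lam : ∀ n, SimpleGraph (Fin n) → ℝ) (β₀ : ∀ n, SimpleGraph (Fin n) → (Fin n → ℝ))
        (βhat : ∀ n, SimpleGraph (Fin n) → (Fin n → ℝ) → (Fin n → ℝ)),
      (∀ n G, c₁ * GTF.tuningScale (GTF.graphDiff G k) ≤ lam n G ∧
        lam n G ≤ c₂ * GTF.tuningScale (GTF.graphDiff G k)) →
      (∀ n G y, GTF.IsGenLasso (GTF.graphDiff G k) (lam n G) y (βhat n G y)) →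
      GTF.IsBigOP (fun n => (SimpleGraph.binomialRandom (Fin n) (p n)).prod (GTF.noise σ n))
        (fun n ω => GTF.sqNorm (βhat n ω.1 (β₀ n ω.1 + ω.2) - β₀ n ω.1) / n)
        (fun n ω => 1 / (n : ℝ) +
          √(Real.log (n * (n * (p n : ℝ)))) /
              (n * (n * (p n : ℝ)) ^ (((k : ℝ) + 1) / 2)) *
            GTF.l1 (GTF.graphDiff ω.1 k *ᵥ β₀ n ω.1))) ∧
    -- Ramanujan `d`-regular graphs
    (∀ (n d : ℕ → ℕ) (G : ∀ m, SimpleGraph (Fin (n m))),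
      Tendsto n atTop atTop → (∀ m, 3 ≤ d m) → (∀ m, GTF.IsRamanujan (G m) (d m)) →
      ∀ (lam : ℕ → ℝ) (β₀ : ∀ m, Fin (n m) → ℝ)
        (βhat : ∀ m, (Fin (n m) → ℝ) → (Fin (n m) → ℝ)),
      (∀ m, c₁ * GTF.tuningScale (GTF.graphDiff (G m) k) ≤ lam m ∧
        lam m ≤ c₂ * GTF.tuningScale (GTF.graphDiff (G m) k)) →
      (∀ m y, GTF.IsGenLasso (GTF.graphDiff (G m) k) (lam m) y (βhat m y)) →
      GTF.IsBigOP (fun m => GTF.noise σ (n m))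
        (fun m ε => GTF.sqNorm (βhat m (β₀ m + ε) - β₀ m) / n m)
        (fun m _ => 1 / (n m : ℝ) +
          √(Real.log ((n m : ℝ) * d m)) /
              ((n m : ℝ) * (d m : ℝ) ^ (((k : ℝ) + 1) / 2)) *
            GTF.l1 (GTF.graphDiff (G m) k *ᵥ β₀ m))) :=
  ⟨fun lam β₀ βhat hlam hβ => GTF.isBigOP_univDiff k hσ hc₁ lam β₀ βhat hlam hβ,
    fun p _ hδ hp lam β₀ βhat hlam hβ =>
      GTF.isBigOP_erdosRenyi k hσ hc₁ p hδ hp lam β₀ βhat hlam hβ,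
    fun n d G hn hd hG lam β₀ βhat hlam hβ =>
      GTF.isBigOP_ramanujan k hσ hc₁ n d G hn hd hG lam β₀ βhat hlam hβ⟩
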